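/- Theorem 3. Let $n\ge 2$ and let $U\subset\mathbb{R}^n$ be a bounded open convex domain whose boundary is a $C^3$ hypersurface with positive normal curvatures. For $x\in U$ and $y\neq 0$ let $x_0$ be the point where the ray $x+\mathbb{R}_+y$ meets $\partial U$; the Funk metric is $\Theta(x,y)=\|y\|/\|x-x_0\|$ (and $\Theta(x,0)=0$). The Funk distance is $d_U(p,q)=\ln\frac{\|p-z\|}{\|q-z\|}$ for $p\ne q$ in $U$, where $z$ is the point where the half line from $p$ through $q$ meets $\partial U$ (and $d_U(p,p)=0$). Write $\mathbf g_y(u,v)=\frac12[\Theta^2]_{y^iy^j}(x,y)\,u^iv^j$ for the fundamental tensor of $\Theta$, $G^i=\frac14 g^{il}\left([\Theta^2]_{x^ky^l}y^k-[\Theta^2]_{x^l}\right)$ for its spray coefficients, and $\nabla_{\dot c}\dot c=\ddot c+2G(c,\dot c)$ for the Chern–Rund covariant derivative of the velocity along a curve $c$. The Rund curvature of a curve $c$ parametrized by arc length, $\Theta(c,\dot c)=1$, is $\mathbf k_R=\sqrt{\mathbf g_{\nabla_{\dot c}\dot c}(\nabla_{\dot c}\dot c,\nabla_{\dot c}\dot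 c)}$. Fix $o\in U$. For $r>0$ and a $2$-dimensional linear subspace $P\subset\mathbb{R}^n$ consider the forward Funk circle $\{q\in U\cap(o+P): d_U(o,q)=r\}$ (for $n=2$ this is the whole forward sphere of radius $r$ about $o$). It is nonempty, and around each of its points it carries a $C^2$ parametrization by arc length. As $r\to\infty$, the Rund curvature of these circles, for every $C^2$ parametrization by arc length, in either orientation, tends to $\sqrt2-1$, uniformly in the point of the circle and in $P$. More precisely, the deviation is of order $e^{-r/2}$: there are constants $C$ and $R$, depending only on $U$ and $o$, such that $|\mathbf k_R-(\sqrt2-1)|\le C e^{-r/2}$ at every point of every such circle with $r\ge R$. -/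

import Mathlib

noncomputable section

namespace FunkGeometry

open Set Filter Topology

/-- Euclidean space of dimension `n`. -/
abbrev E (n : ℕ) : Type := EuclideanSpace ℝ (Fin n)

/-- The `i`-th vector of the standard basis. -/
def e {n : ℕ} (i : Fin n) : E n := EuclideanSpace.single i 1

/-! ### Domains with a `C³` boundary of positive normal curvatures -/

/-- The Euclidean normal curvature, with respect to the normal pointing into `{ρ < 0}`, of the
hypersurface `{ρ = 0}` at its point `p` in the tangent direction `v`: the second fundamental form
`D²ρ(v, v) / ‖Dρ‖` divided by the first one. -/
def normalCurvature {n : ℕ} (ρ : E n → ℝ) (p v : E n) : ℝ :=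
  fderiv ℝ (fderiv ℝ ρ) p v v / (‖fderiv ℝ ρ p‖ * ‖v‖ ^ 2)

/-- The boundary of `U` is a `C³` hypersurface with positive normal curvatures: around each of its
points it is the zero set of a `C³` function `ρ` with nonvanishing differential, `U` being the side
`{ρ < 0}`, and the normal curvatures in all tangent directions are positive. -/
def HasPositivelyCurvedC3Boundary {n : ℕ} (U : Set (E n)) : Prop :=
  ∀ p ∈ frontier U, ∃ ρ : E n → ℝ,
    ContDiffAt ℝ 3 ρ p ∧ fderiv ℝ ρ p ≠ 0 ∧
    (∀ᶠ x in 𝓝 p, (x ∈ U ↔ ρ x < 0) ∧ (x ∈ frontier U ↔ ρ x = 0)) ∧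
    ∀ v : E n, v ≠ 0 → fderiv ℝ ρ p v = 0 → 0 < normalCurvature ρ p v

/-! ### The Funk metric and its distance -/

/-- The point `x₀` at which the ray `x + ℝ₊ y` meets the boundary of `U`.  (For `y = 0` and `x` in
the open set `U` there is none, and the value is `x`.) -/
def exitPoint {n : ℕ} (U : Set (E n)) (x y : E n) : E n :=
  x + sInf {t : ℝ | 0 < t ∧ x + t • y ∈ frontier U} • y

/-- The Funk metric `Θ(x, y) = ‖y‖ / ‖x - x₀‖`; in particular `Θ(x, 0) = 0`. -/
def funkMetric {n : ℕ} (U : Set (E n)) (x y : E n) : ℝ :=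
  ‖y‖ / ‖x - exitPoint U x y‖

/-- The Funk distance `d_U(p, q) = ln (‖p - z‖ / ‖q - z‖)`, where `z` is the point at which the
half line from `p` through `q` meets the boundary of `U`; in particular `d_U(p, p) = 0`. -/
def funkDist {n : ℕ} (U : Set (E n)) (p q : E n) : ℝ :=
  Real.log (‖p - exitPoint U p (q - p)‖ / ‖q - exitPoint U p (q - p)‖)

/-- The forward Funk circle of radius `r` centred at `o` in the plane `o + P`: the section of the
forward sphere `{q ∈ U | d_U(o, q) = r}` by this plane.  For `n = 2` and `P = ⊤` it is the whole
forward sphere. -/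
def funkCircle {n : ℕ} (U : Set (E n)) (o : E n) (P : Submodule ℝ (E n)) (r : ℝ) : Set (E n) :=
  {q | q ∈ U ∧ q - o ∈ P ∧ funkDist U o q = r}

/-! ### Finsler geometry: a Finsler function is given as `F x y`, `x` a point, `y` a vector at `x` -/

/-- The fundamental tensor
`g_y(u, v) = ½ ∂²/∂s∂t F²(x, y + s u + t v) at s = t = 0`, that is `½ [F²]_{yⁱyʲ} uⁱ vʲ`. -/
def fundamentalTensor {n : ℕ} (F : E n → E n → ℝ) (x y u v : E n) : ℝ :=
  1 / 2 * deriv (fun s : ℝ => deriv (fun t : ℝ => F x (y + s • u + t • v) ^ 2) 0) 0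

/-- The matrix `g_{ij}(x, y)`. -/
def metricMatrix {n : ℕ} (F : E n → E n → ℝ) (x y : E n) : Matrix (Fin n) (Fin n) ℝ :=
  Matrix.of fun i j => fundamentalTensor F x y (e i) (e j)

/-- The spray coefficients
`Gⁱ(x, y) = ¼ gⁱˡ ([F²]_{xᵏyˡ} yᵏ - [F²]_{xˡ})`. -/
def sprayCoeff {n : ℕ} (F : E n → E n → ℝ) (x y : E n) (i : Fin n) : ℝ :=
  1 / 4 * ∑ l : Fin n, (metricMatrix F x y)⁻¹ i l *
    ((∑ k : Fin n,
        deriv (fun s : ℝ => deriv (fun t : ℝ => F (x + s • e k) (y + t • e l) ^ 2) 0) 0 * y k)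
      - deriv (fun s : ℝ => F (x + s • e l) y ^ 2) 0)

/-- The Chern-Rund covariant derivative `∇_{ċ} ċ` of the velocity along the curve `c`
(with reference vector `ċ`):
`c̈ⁱ + Γⁱ_{jk}(c, ċ) ċʲ ċᵏ = c̈ⁱ + 2 Gⁱ(c, ċ)`. -/
def covariantAcceleration {n : ℕ} (F : E n → E n → ℝ) (c : ℝ → E n) (s : ℝ) : E n :=
  deriv (deriv c) s + (2 : ℝ) • WithLp.toLp 2 (sprayCoeff F (c s) (deriv c s))

/-- The Rund curvature `√(g_a(a, a))`, `a = ∇_{ċ} ċ`, of a curve `c` parametrized by arc length,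
at the parameter `s`. -/
def rundCurvature {n : ℕ} (F : E n → E n → ℝ) (c : ℝ → E n) (s : ℝ) : ℝ :=
  Real.sqrt (fundamentalTensor F (c s) (covariantAcceleration F c s)
    (covariantAcceleration F c s) (covariantAcceleration F c s))

/-- Around the parameter `s₀`, the curve `c` is a `C²` curve parametrized by its Finsler arc length
(`F(c, ċ) = 1`) that runs on the set `S`. -/
def IsArcLengthParamAt {n : ℕ} (F : E n → E n → ℝ) (S : Set (E n)) (c : ℝ → E n) (s₀ : ℝ) : Prop :=
  ContDiffAt ℝ 2 c s₀ ∧ ∀ᶠ s in 𝓝 s₀, c s ∈ S ∧ F (c s) (deriv c s) = 1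

end FunkGeometry

end

/-! ### Proof. -/

noncomputable section

namespace FunkGeometry

open Set Filter Topology

/-! `funkMetric U x` is the gauge of `U - x`, so `Θ(x, y) = 1` means `x + y ∈ ∂U`: all indicatrices
are translates of the one hypersurface `∂U`. Hence Okada's identity `Θ_x = Θ Θ_y`
(`fderiv_funkMetric_left`), the spray `G = ½ Θ y` (`sprayCoeff_eq`), and the covariant acceleration
`a = c̈ + ċ` along an arc length curve. As `g_a(a, a) = Θ(c, a)²`, the curvature `k` is determined
by: for `T > 0`, `T k < 1` iff `c + T a ∈ U`.

Put `ε = e^{-r}` and `L = ½ Θ(o, ·)²`, so that `∂U - o = {L = 1/2}`. The circle is `c = o + (1 - ε)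
z` with `L z = 1/2`, and with `τ = ċ` the arc length condition says that `w = (1 - ε) z + τ` also
satisfies `L w = 1/2`. Differentiating, `τ` is tangent at `z` and `a = ẇ` is tangent at `w`; in the
plane `P` one has `a = α τ + β z` (`exists_tangent_data`). Strict convexity gives `τ = O(√ε)`, and
Taylor expansion at `z` gives `D²L(z)(τ, τ) = 2ε + O(ε^{3/2})`, `α = 1 + O(√ε)`, `β = -2ε +
O(ε^{3/2})`. Therefore `L(c - o + T a) = 1/2 + ε (T² - 2T - 1) + O(ε^{3/2})`
(`IsMinkowskiEnergy.isBigO_ray`). So `1/k` is within `O(√ε)` of the root `1 + √2`, and `k = √2 - 1 +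
O(e^{-r/2})` (`abs_sub_sqrt_two_sub_one_le`). The constants are uniform because they come from
compactness of annuli around the level set of `L`. -/

/-- A bounded open convex set. -/
structure IsFunkDomain {n : ℕ} (U : Set (E n)) : Prop where
  isOpen : IsOpen U
  isBounded : Bornology.IsBounded U
  convex : Convex ℝ U

/-! ### The Funk metric as a gauge, and Funk circles as its level sets. -/

section Gauge

variable {n : ℕ} {U : Set (E n)}

theorem IsFunkDomain.preimage_mem_nhds (hU : IsFunkDomain U) {x : E n} (hx : x ∈ U) :
    (fun v => x + v) ⁻¹' U ∈ 𝓝 (0 : E n) :=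
  (continuous_const_add x).continuousAt.preimage_mem_nhds
    (by simpa using hU.isOpen.mem_nhds hx)

theorem IsFunkDomain.convex_preimage (hU : IsFunkDomain U) (x : E n) :
    Convex ℝ ((fun v => x + v) ⁻¹' U) := by
  simpa [add_comm] using hU.convex.translate_preimage_left x

theorem gauge_lt_one_iff (hU : IsFunkDomain U) {x : E n} (hx : x ∈ U) (y : E n) :
    gauge ((fun v => x + v) ⁻¹' U) y < 1 ↔ x + y ∈ U := by
  rw [gauge_lt_one_iff_mem_interior (hU.convex_preimage x) (hU.preimage_mem_nhds hx),
    (hU.isOpen.preimage (continuous_const_add x)).interior_eq]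
  rfl

theorem gauge_eq_one_iff (hU : IsFunkDomain U) {x : E n} (hx : x ∈ U) (y : E n) :
    gauge ((fun v => x + v) ⁻¹' U) y = 1 ↔ x + y ∈ frontier U := by
  rw [gauge_eq_one_iff_mem_frontier (hU.convex_preimage x) (hU.preimage_mem_nhds hx)]
  have := (Homeomorph.addLeft x).preimage_frontier U
  rw [show (fun v => x + v) = ⇑(Homeomorph.addLeft x) from rfl, ← this]
  rfl

theorem gauge_pos_iff (hU : IsFunkDomain U) {x : E n} (hx : x ∈ U) (y : E n) :
    0 < gauge ((fun v => x + v) ⁻¹' U) y ↔ y ≠ 0 := by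
  refine gauge_pos (absorbent_nhds_zero (hU.preimage_mem_nhds hx)) ?_
  rw [NormedSpace.isVonNBounded_iff]
  obtain ⟨C, hC⟩ := isBounded_iff_forall_norm_le.1 hU.isBounded
  refine isBounded_iff_forall_norm_le.2 ⟨C + ‖x‖, fun v hv => ?_⟩
  have h := norm_sub_le (x + v) x
  rw [add_sub_cancel_left] at h
  linarith [hC _ hv]

/-- A ray from a point of the domain meets the boundary at the reciprocal of the gauge. -/
theorem setOf_mem_frontier_eq (hU : IsFunkDomain U) {x : E n} (hx : x ∈ U) {y : E n}
    (hy : y ≠ 0) :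
    {t : ℝ | 0 < t ∧ x + t • y ∈ frontier U} = {(gauge ((fun v => x + v) ⁻¹' U) y)⁻¹} := by
  have hg := (gauge_pos_iff hU hx y).2 hy
  ext t
  simp only [mem_ofPred_eq, mem_singleton_iff]
  constructor
  · rintro ⟨ht, h⟩
    rw [← gauge_eq_one_iff hU hx, gauge_smul_of_nonneg ht.le, smul_eq_mul] at h
    exact eq_inv_of_mul_eq_one_left h
  · rintro rfl
    refine ⟨inv_pos.2 hg, ?_⟩
    rw [← gauge_eq_one_iff hU hx, gauge_smul_of_nonneg (inv_pos.2 hg).le, smul_eq_mul,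
      inv_mul_cancel₀ hg.ne']

theorem funkMetric_eq_gauge (hU : IsFunkDomain U) {x : E n} (hx : x ∈ U) (y : E n) :
    funkMetric U x y = gauge ((fun v => x + v) ⁻¹' U) y := by
  rcases eq_or_ne y 0 with rfl | hy
  · simp [funkMetric]
  have hg := (gauge_pos_iff hU hx y).2 hy
  simp only [funkMetric, exitPoint, setOf_mem_frontier_eq hU hx hy, csInf_singleton]
  rw [sub_add_cancel_left, norm_neg, norm_smul, Real.norm_of_nonneg (inv_pos.2 hg).le]
  have := norm_pos_iff.2 hy
  field_simp

theorem exitPoint_eq (hU : IsFunkDomain U) {x : E n} (hx : x ∈ U) {y : E n} (hy : y ≠ 0) :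
    exitPoint U x y = x + (funkMetric U x y)⁻¹ • y := by
  rw [funkMetric_eq_gauge hU hx, exitPoint, setOf_mem_frontier_eq hU hx hy, csInf_singleton]

theorem funkMetric_smul (hU : IsFunkDomain U) {x : E n} (hx : x ∈ U) {t : ℝ} (ht : 0 ≤ t)
    (y : E n) : funkMetric U x (t • y) = t * funkMetric U x y := by
  rw [funkMetric_eq_gauge hU hx, funkMetric_eq_gauge hU hx, gauge_smul_of_nonneg ht, smul_eq_mul]

theorem funkMetric_zero (x : E n) : funkMetric U x 0 = 0 := by
  simp [funkMetric]

theorem funkMetric_nonneg (x y : E n) : 0 ≤ funkMetric U x y := by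
  unfold funkMetric; positivity

theorem funkMetric_pos (hU : IsFunkDomain U) {x : E n} (hx : x ∈ U) {y : E n} (hy : y ≠ 0) :
    0 < funkMetric U x y := by
  rw [funkMetric_eq_gauge hU hx]
  exact (gauge_pos_iff hU hx y).2 hy

theorem funkMetric_lt_one_iff (hU : IsFunkDomain U) {x : E n} (hx : x ∈ U) (y : E n) :
    funkMetric U x y < 1 ↔ x + y ∈ U := by
  rw [funkMetric_eq_gauge hU hx, gauge_lt_one_iff hU hx]

theorem funkMetric_eq_one_iff (hU : IsFunkDomain U) {x : E n} (hx : x ∈ U) (y : E n) :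
    funkMetric U x y = 1 ↔ x + y ∈ frontier U := by
  rw [funkMetric_eq_gauge hU hx, gauge_eq_one_iff hU hx]

theorem continuous_funkMetric (hU : IsFunkDomain U) {x : E n} (hx : x ∈ U) :
    Continuous (funkMetric U x) := by
  rw [funext (funkMetric_eq_gauge hU hx)]
  exact continuous_gauge (hU.convex_preimage x) (hU.preimage_mem_nhds hx)

theorem funkMetric_eq_iff (hU : IsFunkDomain U) {x : E n} (hx : x ∈ U) (y : E n) {a : ℝ}
    (ha : 0 < a) : funkMetric U x y = a ↔ x + a⁻¹ • y ∈ frontier U := by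
  rw [← funkMetric_eq_one_iff hU hx, funkMetric_smul hU hx (inv_pos.2 ha).le,
    inv_mul_eq_one₀ ha.ne', eq_comm]

/-- With `f = Θ(o, q - o)` the exit point is `o + f⁻¹ (q - o)`, so the quotient of distances is `f⁻¹
/ (f⁻¹ - 1) = 1 / (1 - f)`. -/
theorem funkDist_eq (hU : IsFunkDomain U) {o q : E n} (ho : o ∈ U) (hq : q ∈ U) (hne : q ≠ o) :
    funkDist U o q = -Real.log (1 - funkMetric U o (q - o)) := by
  have hy : q - o ≠ 0 := sub_ne_zero.2 hne
  have hF := funkMetric_pos hU ho hy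
  have h1 : funkMetric U o (q - o) < 1 := by
    rw [funkMetric_lt_one_iff hU ho]
    simpa using hq
  rw [funkDist, exitPoint_eq hU ho hy, ← Real.log_inv]
  congr 1
  set f := funkMetric U o (q - o)
  have e1 : o - (o + f⁻¹ • (q - o)) = (-f⁻¹) • (q - o) := by module
  have e2 : q - (o + f⁻¹ • (q - o)) = (1 - f⁻¹) • (q - o) := by module
  have hn : ‖q - o‖ ≠ 0 := norm_ne_zero_iff.2 hy
  have h2 : 1 ≤ f⁻¹ := (one_le_inv₀ hF).2 h1.le
  have h3 : 1 - f ≠ 0 := by linarith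
  rw [e1, e2, norm_smul, norm_smul, norm_neg, Real.norm_of_nonneg (inv_pos.2 hF).le,
    Real.norm_of_nonpos (by linarith), mul_div_mul_right _ _ hn]
  rw [neg_sub, show f⁻¹ - 1 = (1 - f) / f by field_simp]
  field_simp

/-- Forward spheres about `o` are the homothetic images of `∂U` with centre `o` and ratio `1 -
e^{-r}`. -/
theorem mem_funkCircle_iff (hU : IsFunkDomain U) {o : E n} (ho : o ∈ U)
    (P : Submodule ℝ (E n)) {r : ℝ} (hr : 0 < r) (q : E n) :
    q ∈ funkCircle U o P r ↔ q - o ∈ P ∧ funkMetric U o (q - o) = 1 - Real.exp (-r) := by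
  have he : Real.exp (-r) < 1 := by simpa using hr
  have he' := Real.exp_pos (-r)
  constructor
  · rintro ⟨hq, hP, hd⟩
    have hne : q ≠ o := by
      rintro rfl
      -- At the centre the distance is `log (0 / 0) = 0`, against `r > 0`.
      simp [funkDist, exitPoint] at hd
      exact hr.ne hd
    have h1 : funkMetric U o (q - o) < 1 := by
      rw [funkMetric_lt_one_iff hU ho]
      simpa using hq
    rw [funkDist_eq hU ho hq hne] at hd
    refine ⟨hP, ?_⟩
    rw [← hd, neg_neg, Real.exp_log (by linarith)]
    ring
  · rintro ⟨hP, hf⟩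
    have hq : q ∈ U := by
      have : funkMetric U o (q - o) < 1 := by linarith
      rw [funkMetric_lt_one_iff hU ho] at this
      simpa using this
    have hne : q ≠ o := by
      rintro rfl
      rw [sub_self, funkMetric_zero] at hf
      linarith
    refine ⟨hq, hP, ?_⟩
    rw [funkDist_eq hU ho hq hne, hf]
    simp

end Gauge

/-! ### Derivatives along lines and Euler's relation. -/

section Lines

variable {V W : Type*} [NormedAddCommGroup V] [NormedSpace ℝ V]
  [NormedAddCommGroup W] [NormedSpace ℝ W]

theorem hasDerivAt_add_smul (y w : V) (t : ℝ) : HasDerivAt (fun t : ℝ => y + t • w) w t := by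
  simpa using ((hasDerivAt_id t).smul_const w).const_add y

theorem hasDerivAt_comp_add_smul {f : V → W} {y w : V} {t : ℝ}
    (hf : DifferentiableAt ℝ f (y + t • w)) :
    HasDerivAt (fun t : ℝ => f (y + t • w)) (fderiv ℝ f (y + t • w) w) t :=
  hf.hasFDerivAt.comp_hasDerivAt t (hasDerivAt_add_smul y w t)

theorem hasDerivAt_comp_add_smul_zero {f : V → W} {y : V} (hf : DifferentiableAt ℝ f y) (w : V) :
    HasDerivAt (fun t : ℝ => f (y + t • w)) (fderiv ℝ f y w) 0 := by
  simpa using hasDerivAt_comp_add_smul (f := f) (y := y) (w := w) (t := 0) (by simpa using hf)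

theorem eventually_differentiableAt {f : V → W} {y : V} (hf : ContDiffAt ℝ 2 f y) :
    ∀ᶠ z in 𝓝 y, DifferentiableAt ℝ f z :=
  (hf.eventually (by simp)).mono fun _ h => h.differentiableAt (by norm_num)

theorem differentiableAt_fderiv {f : V → W} {y : V} (hf : ContDiffAt ℝ 2 f y) :
    DifferentiableAt ℝ (fderiv ℝ f) y :=
  (hf.fderiv_right (m := 1) (by norm_num)).differentiableAt (by norm_num)

theorem tendsto_add_smul_zero (y w : V) : Tendsto (fun t : ℝ => y + t • w) (𝓝 0) (𝓝 y) := by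
  have : Continuous fun t : ℝ => y + t • w := by fun_prop
  simpa using this.tendsto 0

theorem hasDerivAt_fderiv_add_smul_zero {f : V → W} {y : V} (hf : ContDiffAt ℝ 2 f y) (w v : V) :
    HasDerivAt (fun t : ℝ => fderiv ℝ f (y + t • w) v) (fderiv ℝ (fderiv ℝ f) y w v) 0 := by
  have h := hasDerivAt_comp_add_smul_zero (differentiableAt_fderiv hf) w
  simpa using h.clm_apply (hasDerivAt_const 0 v)

/-- Translates the iterated one-variable derivatives in the definitions of the fundamental tensor
and the spray into second Fréchet derivatives. -/
theorem deriv_deriv_add_smul {f : V → W} {y : V} (hf : ContDiffAt ℝ 2 f y) (u v : V) :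
    deriv (fun s : ℝ => deriv (fun t : ℝ => f (y + s • u + t • v)) 0) 0 =
      fderiv ℝ (fderiv ℝ f) y u v := by
  rw [← (hasDerivAt_fderiv_add_smul_zero hf u v).deriv]
  apply EventuallyEq.deriv_eq
  filter_upwards [(tendsto_add_smul_zero y u).eventually (eventually_differentiableAt hf)] with s hs
  exact (hasDerivAt_comp_add_smul_zero hs v).deriv

/-- Differentiating `Df(y) y = k f(y)`. -/
theorem fderiv_fderiv_apply_self_of_euler {f : V → ℝ} {y : V} (hf : ContDiffAt ℝ 2 f y) {k : ℝ}
    (he : ∀ᶠ z in 𝓝 y, fderiv ℝ f z z = k * f z) (u : V) :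
    fderiv ℝ (fderiv ℝ f) y u y = (k - 1) * fderiv ℝ f y u := by
  have h1 := (hasDerivAt_comp_add_smul_zero (differentiableAt_fderiv hf) u).clm_apply
    (hasDerivAt_add_smul y u 0)
  have h2 := (hasDerivAt_comp_add_smul_zero (hf.differentiableAt (by norm_num)) u).const_mul k
  have h3 := h1.unique (h2.congr_of_eventuallyEq ((tendsto_add_smul_zero y u).eventually he))
  simp only [zero_smul, add_zero] at h3
  linarith

theorem fderiv_fderiv_comm {f : V → ℝ} {y : V} (hf : ContDiffAt ℝ 2 f y) (u v : V) :
    fderiv ℝ (fderiv ℝ f) y u v = fderiv ℝ (fderiv ℝ f) y v u :=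
  (hf.isSymmSndFDerivAt (by simp)).eq u v

end Lines

/-! ### Smoothness, Okada's identity and strong convexity of the Funk metric. -/

section Smooth

variable {n : ℕ} {U : Set (E n)}

/-- A segment from a point of the domain to a boundary point is transversal to the boundary. -/
theorem fderiv_sub_pos_of_mem (hU : IsFunkDomain U) {x p : E n} (hx : x ∈ U)
    (hp : p ∈ frontier U) {ρ : E n → ℝ} (hρ : DifferentiableAt ℝ ρ p) (hρ0 : fderiv ℝ ρ p ≠ 0)
    (hloc : ∀ᶠ z in 𝓝 p, (z ∈ U ↔ ρ z < 0) ∧ (z ∈ frontier U ↔ ρ z = 0)) :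
    0 < fderiv ℝ ρ p (p - x) := by
  -- The half-open segment from `x'` towards `p` stays in `U`, where `ρ < 0 = ρ p`, so the one-sided
  -- derivative of `ρ` at `p` towards `x'` is nonpositive.
  have key : ∀ x' ∈ U, fderiv ℝ ρ p (x' - p) ≤ 0 := by
    intro x' hx'
    have h0 : ρ p = 0 := (hloc.self_of_nhds).2.1 hp
    have hd := (hasDerivAt_comp_add_smul_zero hρ (x' - p)).tendsto_slope_zero_right
    refine le_of_tendsto hd ?_
    have h1 := ((tendsto_add_smul_zero p (x' - p)).eventually hloc).filter_mono
      (nhdsWithin_le_nhds (s := Ioi (0 : ℝ)))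
    filter_upwards [h1, Ioo_mem_nhdsGT (zero_lt_one' ℝ)] with t ht ht'
    have hmem : p + t • (x' - p) ∈ U := by
      have := hU.convex.openSegment_interior_closure_subset_interior
        (by rwa [hU.isOpen.interior_eq]) (frontier_subset_closure hp)
        (show p + t • (x' - p) ∈ openSegment ℝ x' p from
          ⟨t, 1 - t, ht'.1, by linarith [ht'.2], by ring, by module⟩)
      exact interior_subset this
    have := ht.1.1 hmem
    simp only [zero_smul, add_zero, zero_add, h0, sub_zero, smul_eq_mul]
    exact mul_nonpos_of_nonneg_of_nonpos (inv_pos.2 ht'.1).le this.le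
  have hle := key x hx
  rw [← neg_sub x p, map_neg]
  refine (neg_nonneg.2 hle).lt_of_ne' fun h => hρ0 ?_
  rw [neg_eq_zero] at h
  -- In the case of equality `key` applies to all `x + t v` near `x`, which makes the linear form
  -- `Dρ(p)` nonpositive everywhere, hence zero.
  have hall : ∀ v, fderiv ℝ ρ p v ≤ 0 := by
    intro v
    have h1 : ∀ᶠ t : ℝ in 𝓝[>] 0, x + t • v ∈ U :=
      ((tendsto_add_smul_zero x v).eventually (hU.isOpen.mem_nhds hx)).filter_mono
        nhdsWithin_le_nhds
    obtain ⟨t, ht, ht0⟩ := (h1.and self_mem_nhdsWithin).exists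
    have := key _ ht
    rw [add_sub_right_comm, map_add, h, map_smul, zero_add, smul_eq_mul] at this
    exact nonpos_of_mul_nonpos_right this ht0
  ext v
  have h1 := hall v
  have h2 := hall (-v)
  rw [map_neg] at h2
  simp only [zero_apply]
  linarith

/-- The Funk metric is `C³` off the zero section. -/
theorem contDiffAt_funkMetric (hU : IsFunkDomain U) (hUk : HasPositivelyCurvedC3Boundary U)
    {x y : E n} (hx : x ∈ U) (hy : y ≠ 0) :
    ContDiffAt ℝ 3 (fun p : E n × E n => funkMetric U p.1 p.2) (x, y) := by
  have hF := funkMetric_pos hU hx hy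
  have hp : x + (funkMetric U x y)⁻¹ • y ∈ frontier U := (funkMetric_eq_iff hU hx y hF).1 rfl
  obtain ⟨ρ, hρ, hρ0, hloc, -⟩ := hUk _ hp
  have htr := fderiv_sub_pos_of_mem hU hx hp (hρ.differentiableAt (by norm_num)) hρ0 hloc
  set a := (funkMetric U x y)⁻¹ with ha
  have ha0 : 0 < a := inv_pos.2 hF
  set u : (E n × E n) × ℝ := ((x, y), a)
  -- The implicit function theorem solves `ρ(x + t y) = 0` for `t = 1 / Θ(x, y)`; the `t`-derivative
  -- `Dρ(y)` is nonzero by transversality.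
  set f : (E n × E n) × ℝ → ℝ := fun q => ρ (q.1.1 + q.2 • q.1.2)
  have hin : ContDiffAt ℝ 3 (fun q : (E n × E n) × ℝ => q.1.1 + q.2 • q.1.2) u := by fun_prop
  have hf : ContDiffAt ℝ 3 f u := ContDiffAt.comp u (g := ρ) hρ hin
  have hfu : f u = 0 := (hloc.self_of_nhds).2.1 hp
  have hdu : fderiv ℝ f u (0, 1) = fderiv ℝ ρ (x + a • y) y := by
    have h1 := hasDerivAt_comp_add_smul_zero (hf.differentiableAt (by norm_num)) ((0, 1) : (E n × E n) × ℝ)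
    have h2 : HasDerivAt (fun t : ℝ => ρ ((x + a • y) + t • y)) (fderiv ℝ ρ (x + a • y) y) 0 :=
      hasDerivAt_comp_add_smul_zero (hρ.differentiableAt (by norm_num)) y
    refine h1.unique (h2.congr_of_eventuallyEq (Eventually.of_forall fun t => ?_))
    simp only [f, u, Prod.smul_mk, Prod.mk_add_mk, smul_zero, add_zero, smul_eq_mul, mul_one]
    congr 1
    module
  have hb : fderiv ℝ ρ (x + a • y) y ≠ 0 := by
    rw [add_sub_cancel_left, map_smul, smul_eq_mul] at htr
    exact (pos_of_mul_pos_right htr ha0.le).ne'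
  have hinv : (fderiv ℝ f u ∘L .inr ℝ (E n × E n) ℝ).IsInvertible := by
    refine ⟨ContinuousLinearEquiv.unitsEquivAut ℝ (Units.mk0 _ hb), ?_⟩
    ext
    simp [hdu]
  set ψ := hf.implicitFunction (by norm_num) hinv
  have hψ : ContDiffAt ℝ 3 ψ (x, y) := hf.contDiffAt_implicitFunction (by norm_num) hinv
  have hψ0 : ψ (x, y) = a := hf.implicitFunction_apply_self (by norm_num) hinv
  have hev : ∀ᶠ q in 𝓝 (x, y), f (q, ψ q) = f u :=
    hf.eventually_apply_implicitFunction (by norm_num) hinv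
  have hpos : ∀ᶠ q in 𝓝 (x, y), 0 < ψ q :=
    hψ.continuousAt.eventually (lt_mem_nhds (by rwa [hψ0]))
  have hmem : ∀ᶠ q : E n × E n in 𝓝 (x, y), q.1 ∈ U :=
    continuousAt_fst.eventually (hU.isOpen.mem_nhds hx)
  have hc : ContinuousAt (fun q : E n × E n => q.1 + ψ q • q.2) (x, y) :=
    continuousAt_fst.add (hψ.continuousAt.smul continuousAt_snd)
  have hnear := hc.eventually (by simpa only [hψ0] using hloc)
  refine (hψ.inv (by rw [hψ0]; exact ha0.ne')).congr_of_eventuallyEq ?_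
  filter_upwards [hev, hpos, hmem, hnear] with q h1 h2 h3 h4
  refine (funkMetric_eq_iff hU h3 _ (inv_pos.2 h2)).2 ?_
  rw [inv_inv, h4.2, ← hfu, ← h1]

theorem contDiffAt_funkMetric_right (hU : IsFunkDomain U) (hUk : HasPositivelyCurvedC3Boundary U)
    {x y : E n} (hx : x ∈ U) (hy : y ≠ 0) : ContDiffAt ℝ 3 (funkMetric U x) y :=
  (contDiffAt_funkMetric hU hUk hx hy).comp y (f := fun z => (x, z)) (by fun_prop)

/-- Okada's lemma: `∂F/∂x = F ∂F/∂y` for the Funk metric. -/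
theorem fderiv_funkMetric_left (hU : IsFunkDomain U) (hUk : HasPositivelyCurvedC3Boundary U)
    {x y : E n} (hx : x ∈ U) (hy : y ≠ 0) (v : E n) :
    fderiv ℝ (fun p : E n × E n => funkMetric U p.1 p.2) (x, y) (v, 0) =
      funkMetric U x y * fderiv ℝ (fun p : E n × E n => funkMetric U p.1 p.2) (x, y) (0, v) := by
  set Φ := fun p : E n × E n => funkMetric U p.1 p.2
  have hd : DifferentiableAt ℝ Φ (x, y) :=
    (contDiffAt_funkMetric hU hUk hx hy).differentiableAt (by norm_num)
  have hF : 0 < Φ (x, y) := funkMetric_pos hU hx hy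
  have h1 := hasDerivAt_comp_add_smul_zero hd ((0, v) : E n × E n)
  have h1' := (hasDerivAt_id (0 : ℝ)).div h1 (by simpa using hF.ne')
  -- With `b = Θ(x, y + s v)`, the boundary point `x + b⁻¹ (y + s v)` is also `(x + (s / b) v) + b⁻¹
  -- y`, so `Θ(x + (s / b) v, y) = b`. The identity is the derivative of this equality at `s = 0`.
  have h2 : HasDerivAt (fun s : ℝ => ((x, y) : E n × E n) + (s / Φ ((x, y) + s • (0, v))) •
      ((v, 0) : E n × E n)) ((Φ (x, y))⁻¹ • (v, 0)) 0 := by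
    have h := (h1'.smul_const ((v, 0) : E n × E n)).const_add (x, y)
    have hne : Φ (x, y) / Φ (x, y) ^ 2 = (Φ (x, y))⁻¹ := by field_simp
    simpa [hne] using h
  have h3 : HasDerivAt (fun s : ℝ => Φ ((x, y) + (s / Φ ((x, y) + s • (0, v))) • (v, 0)))
      (fderiv ℝ Φ (x, y) ((Φ (x, y))⁻¹ • (v, 0))) 0 :=
    HasFDerivAt.comp_hasDerivAt (l := Φ) 0 (by simpa using hd.hasFDerivAt) h2
  have hmem : ∀ᶠ s : ℝ in 𝓝 0, x + (s / Φ ((x, y) + s • (0, v))) • v ∈ U := by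
    have : ContinuousAt (fun s : ℝ => x + (s / Φ ((x, y) + s • (0, v))) • v) 0 :=
      continuousAt_const.add ((h1'.continuousAt).smul continuousAt_const)
    exact this.eventually (by simpa using hU.isOpen.mem_nhds hx)
  have hpos : ∀ᶠ s : ℝ in 𝓝 0, 0 < Φ ((x, y) + s • (0, v)) :=
    h1.continuousAt.eventually (lt_mem_nhds (by simpa using hF))
  have heq := h3.unique (h1.congr_of_eventuallyEq ?_)
  · rw [map_smul, smul_eq_mul] at heq
    rw [← heq, show funkMetric U x y = Φ (x, y) from rfl]
    field_simp
  · filter_upwards [hmem, hpos] with s hs hs'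
    have hval : Φ ((x, y) + s • (0, v)) = funkMetric U x (y + s • v) := by simp [Φ]
    have := (funkMetric_eq_iff hU hx (y + s • v) (hval ▸ hs')).1 rfl
    rw [← hval] at this
    set b := Φ ((x, y) + s • (0, v))
    have h5 : Φ ((x, y) + (s / b) • (v, 0)) = funkMetric U (x + (s / b) • v) y := by simp [Φ]
    rw [h5, funkMetric_eq_iff hU hs y hs']
    convert this using 1
    rw [div_eq_mul_inv]
    module

theorem fderiv_funkMetric_self (hU : IsFunkDomain U) (hUk : HasPositivelyCurvedC3Boundary U)
    {x y : E n} (hx : x ∈ U) (hy : y ≠ 0) :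
    fderiv ℝ (funkMetric U x) y y = funkMetric U x y := by
  have h1 := hasDerivAt_comp_add_smul_zero
    ((contDiffAt_funkMetric_right hU hUk hx hy).differentiableAt (by norm_num)) y
  have h2 : HasDerivAt (fun t : ℝ => (1 + t) * funkMetric U x y) (1 * funkMetric U x y) 0 :=
    ((hasDerivAt_id (0 : ℝ)).const_add 1).mul_const _
  rw [one_mul] at h2
  refine h1.unique (h2.congr_of_eventuallyEq ?_)
  filter_upwards [lt_mem_nhds (show (-1 : ℝ) < 0 by norm_num)] with t ht
  rw [← funkMetric_smul hU hx (by linarith), add_smul, one_smul]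

theorem fderiv_fderiv_funkMetric_self (hU : IsFunkDomain U)
    (hUk : HasPositivelyCurvedC3Boundary U) {x y : E n} (hx : x ∈ U) (hy : y ≠ 0) (u : E n) :
    fderiv ℝ (fderiv ℝ (funkMetric U x)) y u y = 0 := by
  rw [fderiv_fderiv_apply_self_of_euler (k := 1)
    ((contDiffAt_funkMetric_right hU hUk hx hy).of_le (by norm_num))]
  · ring
  · filter_upwards [isOpen_ne.mem_nhds hy] with z hz
    rw [fderiv_funkMetric_self hU hUk hx hz, one_mul]

/-- The Funk metric is strictly convex in the directions tangent to its level sets. -/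
theorem fderiv_fderiv_funkMetric_pos_of_tangent (hU : IsFunkDomain U)
    (hUk : HasPositivelyCurvedC3Boundary U) {x y : E n} (hx : x ∈ U) (hy : y ≠ 0) {w : E n}
    (hw : w ≠ 0) (hfw : fderiv ℝ (funkMetric U x) y w = 0) :
    0 < fderiv ℝ (fderiv ℝ (funkMetric U x)) y w w := by
  have hF := funkMetric_pos hU hx hy
  have hf := (contDiffAt_funkMetric_right hU hUk hx hy).of_le (show (2 : WithTop ℕ∞) ≤ 3 by norm_num)
  have hp : x + (funkMetric U x y)⁻¹ • y ∈ frontier U := (funkMetric_eq_iff hU hx y hF).1 rfl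
  obtain ⟨ρ, hρ, hρ0, hloc, hcurv⟩ := hUk _ hp
  have htr := fderiv_sub_pos_of_mem hU hx hp (hρ.differentiableAt (by norm_num)) hρ0 hloc
  have hρ2 := hρ.of_le (show (2 : WithTop ℕ∞) ≤ 3 by norm_num)
  set f := funkMetric U x
  set p := x + (f y)⁻¹ • y
  -- The curve `c(t) = x + (y + t w) / Θ(x, y + t w)` runs on `∂U`, with velocity `w / Θ` and
  -- acceleration `g₂ y` at `0`. Differentiating `ρ(c(t)) = 0` twice gives `D²ρ(w, w) / Θ² + g₂
  -- Dρ(y) = 0`; positive curvature and `Dρ(y) > 0` force `g₂ < 0`.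
  set g : ℝ → ℝ := fun t => (f (y + t • w))⁻¹
  set g₁ : ℝ → ℝ := fun t => -fderiv ℝ f (y + t • w) w / f (y + t • w) ^ 2
  set g₂ : ℝ := -fderiv ℝ (fderiv ℝ f) y w w / f y ^ 2
  have hg : ∀ᶠ t in 𝓝 0, HasDerivAt g (g₁ t) t := by
    have hpos : ∀ᶠ z in 𝓝 y, f z ≠ 0 := hf.continuousAt.eventually_ne hF.ne'
    filter_upwards [(tendsto_add_smul_zero y w).eventually (eventually_differentiableAt hf),
      (tendsto_add_smul_zero y w).eventually hpos] with t h1 h2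
    exact (hasDerivAt_comp_add_smul h1).inv h2
  have hf' := hasDerivAt_comp_add_smul_zero (hf.differentiableAt (by norm_num)) w
  rw [hfw] at hf'
  have hg₁ : HasDerivAt g₁ g₂ 0 := by
    have h := (hasDerivAt_fderiv_add_smul_zero hf w w).neg.div (hf'.pow 2) (by simpa using hF.ne')
    refine HasDerivAt.congr_deriv (f := g₁) h ?_
    simp only [zero_smul, add_zero, hfw, g₂, Pi.pow_apply, Pi.neg_apply]
    have := hF.ne'
    field_simp
    ring
  have hg0 : g 0 = (f y)⁻¹ := by simp [g]
  have hg₁0 : g₁ 0 = 0 := by simp [g₁, hfw]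
  set c : ℝ → E n := fun t => x + g t • (y + t • w)
  set c₁ : ℝ → E n := fun t => g t • w + g₁ t • (y + t • w)
  have hc : ∀ᶠ t in 𝓝 0, HasDerivAt c (c₁ t) t := by
    filter_upwards [hg] with t ht
    exact (ht.smul (hasDerivAt_add_smul y w t)).const_add x
  have hc₁ : HasDerivAt c₁ (g₂ • y) 0 := by
    have h := (hg.self_of_nhds.smul_const w).add (hg₁.smul (hasDerivAt_add_smul y w 0))
    refine HasDerivAt.congr_deriv (f := c₁) h ?_
    simp [hg₁0]
  have hc0 : c 0 = p := by simp [c, hg0, p]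
  have hc₁0 : c₁ 0 = (f y)⁻¹ • w := by simp [c₁, hg0, hg₁0]
  have hct : Tendsto c (𝓝 0) (𝓝 p) := hc0 ▸ hc.self_of_nhds.continuousAt
  have hzero : ∀ᶠ t in 𝓝 0, ρ (c t) = 0 := by
    have hpos : ∀ᶠ z in 𝓝 y, 0 < f z := hf.continuousAt.eventually (lt_mem_nhds hF)
    filter_upwards [hct.eventually hloc, (tendsto_add_smul_zero y w).eventually hpos] with t h1 h2
    exact h1.2.1 ((funkMetric_eq_iff hU hx _ h2).1 rfl)
  have hzero' : ∀ᶠ t in 𝓝 0, fderiv ℝ ρ (c t) (c₁ t) = 0 := by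
    filter_upwards [hzero.eventually_nhds, hct.eventually (eventually_differentiableAt hρ2), hc]
      with t h1 h2 h3
    exact (h2.hasFDerivAt.comp_hasDerivAt t h3).unique
      ((hasDerivAt_const t (0 : ℝ)).congr_of_eventuallyEq h1)
  have hD : HasDerivAt (fun t => fderiv ℝ ρ (c t))
      (fderiv ℝ (fderiv ℝ ρ) p (c₁ 0)) 0 :=
    HasFDerivAt.comp_hasDerivAt (l := fderiv ℝ ρ) 0
      (by rw [hc0]; exact (differentiableAt_fderiv hρ2).hasFDerivAt) hc.self_of_nhds
  have hsum := (hD.clm_apply hc₁).unique ((hasDerivAt_const 0 (0 : ℝ)).congr_of_eventuallyEq hzero')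
  have htan := hzero'.self_of_nhds
  simp only [hc0, hc₁0, map_smul, smul_eq_mul, smul_apply] at hsum htan
  have hρw : fderiv ℝ ρ p w = 0 := (mul_eq_zero.1 htan).resolve_left (inv_pos.2 hF).ne'
  have hn := hcurv w hw hρw
  have hρww : 0 < fderiv ℝ (fderiv ℝ ρ) p w w := by
    by_contra hcon
    exact hn.not_ge (div_nonpos_of_nonpos_of_nonneg (not_lt.1 hcon) (by positivity))
  have hρy : 0 < fderiv ℝ ρ p y := by
    rw [add_sub_cancel_left, map_smul, smul_eq_mul] at htr
    exact pos_of_mul_pos_right htr (inv_pos.2 hF).le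
  have hg₂ : g₂ < 0 := by
    have h1 : 0 < (f y)⁻¹ * ((f y)⁻¹ * fderiv ℝ (fderiv ℝ ρ) p w w) := by positivity
    by_contra hcon
    have := mul_nonneg (not_lt.1 hcon) hρy.le
    linarith
  by_contra hcon
  exact hg₂.not_ge (div_nonneg (neg_nonneg.2 (not_lt.1 hcon)) (by positivity))

/-- Half the square of the Funk metric at the point `x`. -/
def funkEnergy (U : Set (E n)) (x y : E n) : ℝ := 1 / 2 * funkMetric U x y ^ 2

theorem contDiffAt_funkEnergy (hU : IsFunkDomain U) (hUk : HasPositivelyCurvedC3Boundary U)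
    {x y : E n} (hx : x ∈ U) (hy : y ≠ 0) : ContDiffAt ℝ 3 (funkEnergy U x) y :=
  contDiffAt_const.mul ((contDiffAt_funkMetric_right hU hUk hx hy).pow 2)

theorem fderiv_funkEnergy (hU : IsFunkDomain U) (hUk : HasPositivelyCurvedC3Boundary U)
    {x y : E n} (hx : x ∈ U) (hy : y ≠ 0) (v : E n) :
    fderiv ℝ (funkEnergy U x) y v = funkMetric U x y * fderiv ℝ (funkMetric U x) y v := by
  have h := ((contDiffAt_funkMetric_right hU hUk hx hy).differentiableAt (by norm_num)).hasFDerivAt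
  have := ((h.pow 2).const_mul (1 / 2)).fderiv
  change fderiv ℝ (fun z => 1 / 2 * funkMetric U x z ^ 2) y v = _
  rw [this]
  simp
  ring

theorem fderiv_funkEnergy_self (hU : IsFunkDomain U) (hUk : HasPositivelyCurvedC3Boundary U)
    {x y : E n} (hx : x ∈ U) (hy : y ≠ 0) :
    fderiv ℝ (funkEnergy U x) y y = 2 * funkEnergy U x y := by
  rw [fderiv_funkEnergy hU hUk hx hy, fderiv_funkMetric_self hU hUk hx hy, funkEnergy]
  ring

/-- The fundamental tensor of the Funk metric is positive definite. -/
theorem fderiv_fderiv_funkEnergy_pos (hU : IsFunkDomain U) (hUk : HasPositivelyCurvedC3Boundary U)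
    {x y : E n} (hx : x ∈ U) (hy : y ≠ 0) {v : E n} (hv : v ≠ 0) :
    0 < fderiv ℝ (fderiv ℝ (funkEnergy U x)) y v v := by
  have hF := funkMetric_pos hU hx hy
  have hf := (contDiffAt_funkMetric_right hU hUk hx hy).of_le (show (2 : WithTop ℕ∞) ≤ 3 by norm_num)
  have hL := (contDiffAt_funkEnergy hU hUk hx hy).of_le (show (2 : WithTop ℕ∞) ≤ 3 by norm_num)
  have heq : fderiv ℝ (fderiv ℝ (funkEnergy U x)) y v v =
      fderiv ℝ (funkMetric U x) y v ^ 2 +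
        funkMetric U x y * fderiv ℝ (fderiv ℝ (funkMetric U x)) y v v := by
    have h1 := (hasDerivAt_comp_add_smul_zero (hf.differentiableAt (by norm_num)) v).mul
      (hasDerivAt_fderiv_add_smul_zero hf v v)
    refine (hasDerivAt_fderiv_add_smul_zero hL v v).unique
      ((h1.congr_of_eventuallyEq ?_).congr_deriv ?_)
    · filter_upwards [(tendsto_add_smul_zero y v).eventually (isOpen_ne.mem_nhds hy)] with t ht
      exact fderiv_funkEnergy hU hUk hx ht v
    · simp only [zero_smul, add_zero]
      ring
  rw [heq]
  set f := funkMetric U x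
  -- Split `v` into a part `w` tangent to the level set and a multiple of `y`, which lies in the
  -- kernel of `D²Θ`. If `w = 0`, the term `(DΘ v)²` is positive instead.
  set α := fderiv ℝ f y v / f y
  set w := v - α • y
  have hv' : v = w + α • y := by simp [w]
  have hfw : fderiv ℝ f y w = 0 := by
    simp only [w, map_sub, map_smul, fderiv_funkMetric_self hU hUk hx hy, α, smul_eq_mul, f]
    rw [div_mul_cancel₀ _ hF.ne', sub_self]
  have hvv : fderiv ℝ (fderiv ℝ f) y v v = fderiv ℝ (fderiv ℝ f) y w w := by
    have h0 := fderiv_fderiv_funkMetric_self hU hUk hx hy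
    have h1 : fderiv ℝ (fderiv ℝ f) y y w = 0 := by rw [fderiv_fderiv_comm hf]; exact h0 w
    have h2 := h0 w
    have h3 := h0 y
    rw [hv']
    simp only [map_add, map_smul, add_apply, smul_apply,
      smul_eq_mul]
    simp only [f] at h1 ⊢
    rw [h1, h2, h3]
    ring
  rw [hvv]
  rcases eq_or_ne w 0 with hw | hw
  · have hα : α ≠ 0 := by
      intro h
      rw [hw, h] at hv'
      exact hv (by simpa using hv')
    have : fderiv ℝ f y v ≠ 0 := fun h => hα (by simp [α, h])
    rw [hw]
    simp only [map_zero, mul_zero, add_zero]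
    positivity
  · have := fderiv_fderiv_funkMetric_pos_of_tangent hU hUk hx hy hw hfw
    positivity

end Smooth

/-! ### Fundamental tensor, spray and covariant acceleration of the Funk metric. -/

section Finsler

variable {n : ℕ} {U : Set (E n)}

/-- `g_a(a, a) = F(a)²`, by homogeneity alone. -/
theorem fundamentalTensor_self (hU : IsFunkDomain U) {x : E n} (hx : x ∈ U) (a : E n) :
    fundamentalTensor (funkMetric U) x a a a = funkMetric U x a ^ 2 := by
  have hval : ∀ s t : ℝ, 0 ≤ 1 + s + t →
      funkMetric U x (a + s • a + t • a) ^ 2 = (1 + s + t) ^ 2 * funkMetric U x a ^ 2 := by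
    intro s t h
    rw [show a + s • a + t • a = (1 + s + t) • a by module, funkMetric_smul hU hx h, mul_pow]
  have hin : ∀ᶠ s : ℝ in 𝓝 0, deriv (fun t : ℝ => funkMetric U x (a + s • a + t • a) ^ 2) 0 =
      2 * (1 + s) * funkMetric U x a ^ 2 := by
    filter_upwards [lt_mem_nhds (show (-1 : ℝ) < 0 by norm_num)] with s hs
    have h1 : HasDerivAt (fun t : ℝ => (1 + s + t) ^ 2 * funkMetric U x a ^ 2)
        (2 * (1 + s) * funkMetric U x a ^ 2) 0 := by
      have h := (((hasDerivAt_id (0 : ℝ)).const_add (1 + s)).pow 2).mul_const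
        (funkMetric U x a ^ 2)
      simpa using h
    refine (h1.congr_of_eventuallyEq ?_).deriv
    filter_upwards [lt_mem_nhds (show -(1 + s) < 0 by linarith)] with t ht
    exact hval s t (by linarith)
  have h2 : HasDerivAt (fun s : ℝ => 2 * (1 + s) * funkMetric U x a ^ 2)
      (2 * funkMetric U x a ^ 2) 0 := by
    have h := (((hasDerivAt_id (0 : ℝ)).const_add 1).const_mul 2).mul_const (funkMetric U x a ^ 2)
    simpa using h
  rw [fundamentalTensor, (h2.congr_of_eventuallyEq hin).deriv]
  ring

/-- This also covers `a = 0`, where `Θ²` need not be twice differentiable, since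
`fundamentalTensor_self` rests on homogeneity only. -/
theorem rundCurvature_eq (hU : IsFunkDomain U) {c : ℝ → E n} {s : ℝ} (hc : c s ∈ U) :
    rundCurvature (funkMetric U) c s =
      funkMetric U (c s) (covariantAcceleration (funkMetric U) c s) := by
  rw [rundCurvature, fundamentalTensor_self hU hc, Real.sqrt_sq (funkMetric_nonneg _ _)]

theorem fundamentalTensor_eq (hU : IsFunkDomain U) (hUk : HasPositivelyCurvedC3Boundary U)
    {x y : E n} (hx : x ∈ U) (hy : y ≠ 0) (u v : E n) :
    fundamentalTensor (funkMetric U) x y u v =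
      fderiv ℝ (fderiv ℝ (funkEnergy U x)) y u v := by
  rw [← deriv_deriv_add_smul ((contDiffAt_funkEnergy hU hUk hx hy).of_le (by norm_num))]
  simp only [fundamentalTensor, funkEnergy, deriv_const_mul_field]

theorem sum_smul_e (v : E n) : ∑ i, v i • (e i : E n) = v := by
  ext j
  simp [e, Pi.single_apply]

theorem metricMatrix_mulVec (hU : IsFunkDomain U) (hUk : HasPositivelyCurvedC3Boundary U)
    {x y : E n} (hx : x ∈ U) (hy : y ≠ 0) (v : E n) (i : Fin n) :
    (metricMatrix (funkMetric U) x y).mulVec v.ofLp i =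
      fderiv ℝ (fderiv ℝ (funkEnergy U x)) y (e i) v := by
  conv_rhs => rw [← sum_smul_e v]
  simp only [Matrix.mulVec, dotProduct, metricMatrix, Matrix.of_apply,
    fundamentalTensor_eq hU hUk hx hy, map_sum, map_smul, smul_eq_mul]
  exact Finset.sum_congr rfl fun _ _ => mul_comm _ _

theorem isUnit_metricMatrix (hU : IsFunkDomain U) (hUk : HasPositivelyCurvedC3Boundary U)
    {x y : E n} (hx : x ∈ U) (hy : y ≠ 0) : IsUnit (metricMatrix (funkMetric U) x y) := by
  rw [← Matrix.mulVec_injective_iff_isUnit, ← Matrix.coe_mulVecLin,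
    injective_iff_map_eq_zero]
  intro v hv
  by_contra hne
  have hne' : (WithLp.toLp 2 v : E n) ≠ 0 := fun h => hne (by simpa using congrArg WithLp.ofLp h)
  refine (fderiv_fderiv_funkEnergy_pos hU hUk hx hy hne').ne' ?_
  have hz : ∀ i, fderiv ℝ (fderiv ℝ (funkEnergy U x)) y (e i) (WithLp.toLp 2 v) = 0 := by
    intro i
    rw [← metricMatrix_mulVec hU hUk hx hy]
    exact congrFun hv i
  have hs : fderiv ℝ (fderiv ℝ (funkEnergy U x)) y (WithLp.toLp 2 v) = ∑ i, v i •
      fderiv ℝ (fderiv ℝ (funkEnergy U x)) y (e i) := by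
    conv_lhs => rw [← sum_smul_e (WithLp.toLp 2 v : E n)]
    simp
  rw [hs]
  simp [hz]

theorem fderiv_funkMetric_right (hU : IsFunkDomain U) (hUk : HasPositivelyCurvedC3Boundary U)
    {x y : E n} (hx : x ∈ U) (hy : y ≠ 0) (v : E n) :
    fderiv ℝ (fun p : E n × E n => funkMetric U p.1 p.2) (x, y) (0, v) =
      fderiv ℝ (funkMetric U x) y v := by
  have h1 := hasDerivAt_comp_add_smul_zero
    ((contDiffAt_funkMetric hU hUk hx hy).differentiableAt (by norm_num)) ((0, v) : E n × E n)
  have h2 := hasDerivAt_comp_add_smul_zero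
    ((contDiffAt_funkMetric_right hU hUk hx hy).differentiableAt (by norm_num)) v
  refine h1.unique (h2.congr_of_eventuallyEq (Eventually.of_forall fun t => ?_))
  simp

theorem fderiv_sq_funkMetric_left (hU : IsFunkDomain U) (hUk : HasPositivelyCurvedC3Boundary U)
    {x y : E n} (hx : x ∈ U) (hy : y ≠ 0) (v : E n) :
    fderiv ℝ (fun p : E n × E n => funkMetric U p.1 p.2 ^ 2) (x, y) (v, 0) =
      2 * funkMetric U x y * fderiv ℝ (funkEnergy U x) y v := by
  have h := ((contDiffAt_funkMetric hU hUk hx hy).differentiableAt (by norm_num)).hasFDerivAt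
  rw [(h.pow 2).fderiv]
  simp only [smul_apply, smul_eq_mul, fderiv_funkMetric_left hU hUk hx hy,
    fderiv_funkMetric_right hU hUk hx hy, fderiv_funkEnergy hU hUk hx hy]
  ring

theorem fderiv_fderiv_funkEnergy_self (hU : IsFunkDomain U)
    (hUk : HasPositivelyCurvedC3Boundary U) {x y : E n} (hx : x ∈ U) (hy : y ≠ 0) (u : E n) :
    fderiv ℝ (fderiv ℝ (funkEnergy U x)) y u y = fderiv ℝ (funkEnergy U x) y u := by
  rw [fderiv_fderiv_apply_self_of_euler (k := 2)
    ((contDiffAt_funkEnergy hU hUk hx hy).of_le (by norm_num))]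
  · ring
  · filter_upwards [isOpen_ne.mem_nhds hy] with z hz
    exact fderiv_funkEnergy_self hU hUk hx hz

/-- The spray of the Funk metric is `G = ½ F y`. -/
theorem sprayCoeff_eq (hU : IsFunkDomain U) (hUk : HasPositivelyCurvedC3Boundary U)
    {x y : E n} (hx : x ∈ U) (hy : y ≠ 0) (i : Fin n) :
    sprayCoeff (funkMetric U) x y i = 1 / 2 * funkMetric U x y * y i := by
  set H := fun p : E n × E n => funkMetric U p.1 p.2 ^ 2
  have hH : ContDiffAt ℝ 2 H (x, y) :=
    ((contDiffAt_funkMetric hU hUk hx hy).pow 2).of_le (by norm_num)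
  have hmixed : ∀ l, fderiv ℝ (fderiv ℝ H) (x, y) (y, 0) (0, e l) =
      4 * funkMetric U x y * fderiv ℝ (funkEnergy U x) y (e l) := by
    intro l
    -- By symmetry the `x`-derivative, known from Okada's identity to be `2 Θ DL`, is taken first
    -- and then differentiated in `y`.
    rw [fderiv_fderiv_comm hH]
    have hL := (contDiffAt_funkEnergy hU hUk hx hy).of_le (show (2 : WithTop ℕ∞) ≤ 3 by norm_num)
    have h1 := hasDerivAt_fderiv_add_smul_zero hH ((0, e l) : E n × E n) (y, 0)
    have h2 := ((hasDerivAt_comp_add_smul_zero ((contDiffAt_funkMetric_right hU hUk hx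
      hy).differentiableAt (by norm_num)) (e l)).const_mul 2).mul
      (hasDerivAt_fderiv_add_smul_zero hL (e l) y)
    rw [h1.unique (h2.congr_of_eventuallyEq ?_)]
    · simp only [zero_smul, add_zero, fderiv_funkEnergy_self hU hUk hx hy,
        fderiv_fderiv_funkEnergy_self hU hUk hx hy, fderiv_funkEnergy hU hUk hx hy, funkEnergy]
      ring
    · filter_upwards [(tendsto_add_smul_zero y (e l)).eventually (isOpen_ne.mem_nhds hy)] with t ht
      have := fderiv_sq_funkMetric_left hU hUk hx ht y
      simpa using this
  -- The bracket is `4 Θ DL(e_l) - 2 Θ DL(e_l)`, and `DL(e_l) = (g y)_l` by Euler's relation, so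
  -- `g⁻¹` returns `2 Θ y`.
  have hbr : ∀ l, (∑ k : Fin n, deriv (fun s : ℝ => deriv (fun t : ℝ =>
      funkMetric U (x + s • e k) (y + t • e l) ^ 2) 0) 0 * y k)
      - deriv (fun s : ℝ => funkMetric U (x + s • e l) y ^ 2) 0 =
      2 * funkMetric U x y * (metricMatrix (funkMetric U) x y).mulVec y.ofLp l := by
    intro l
    have h1 : ∀ k, deriv (fun s : ℝ => deriv (fun t : ℝ =>
        funkMetric U (x + s • e k) (y + t • e l) ^ 2) 0) 0 =
        fderiv ℝ (fderiv ℝ H) (x, y) (e k, 0) (0, e l) := by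
      intro k
      rw [← deriv_deriv_add_smul hH]
      simp [H]
    have h2 : deriv (fun s : ℝ => funkMetric U (x + s • e l) y ^ 2) 0 =
        fderiv ℝ H (x, y) (e l, 0) := by
      rw [← (hasDerivAt_comp_add_smul_zero (hH.differentiableAt (by norm_num)) _).deriv]
      simp [H]
    have h3 : ∑ k, fderiv ℝ (fderiv ℝ H) (x, y) (e k, 0) (0, e l) * y k =
        fderiv ℝ (fderiv ℝ H) (x, y) (y, 0) (0, e l) := by
      have hy' : ((y, 0) : E n × E n) = ∑ k, y k • ((e k : E n), (0 : E n)) := by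
        ext1
        · simp [Prod.fst_sum, sum_smul_e]
        · simp [Prod.snd_sum]
      rw [hy', map_sum, sum_apply]
      exact Finset.sum_congr rfl fun k _ => by rw [map_smul, smul_apply, smul_eq_mul, mul_comm]
    rw [Finset.sum_congr rfl fun k _ => by rw [h1 k], h3, h2, hmixed,
      fderiv_sq_funkMetric_left hU hUk hx hy, metricMatrix_mulVec hU hUk hx hy,
      fderiv_fderiv_funkEnergy_self hU hUk hx hy]
    ring
  have hdet : IsUnit (metricMatrix (funkMetric U) x y).det :=
    (Matrix.isUnit_iff_isUnit_det _).1 (isUnit_metricMatrix hU hUk hx hy)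
  have hfin : ((metricMatrix (funkMetric U) x y)⁻¹.mulVec
      ((metricMatrix (funkMetric U) x y).mulVec y.ofLp)) i = y i := by
    rw [Matrix.mulVec_mulVec, Matrix.nonsing_inv_mul _ hdet, Matrix.one_mulVec]
  rw [sprayCoeff, Finset.sum_congr rfl fun l _ => by rw [hbr l], ← hfin]
  simp only [Matrix.mulVec, dotProduct, Finset.mul_sum]
  refine Finset.sum_congr rfl fun l _ => Finset.sum_congr rfl fun j _ => ?_
  ring

theorem covariantAcceleration_eq (hU : IsFunkDomain U) (hUk : HasPositivelyCurvedC3Boundary U)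
    {c : ℝ → E n} {s : ℝ} (hc : c s ∈ U) (h1 : funkMetric U (c s) (deriv c s) = 1) :
    covariantAcceleration (funkMetric U) c s = deriv (deriv c) s + deriv c s := by
  have hne : deriv c s ≠ 0 := by
    intro h
    rw [h, funkMetric_zero] at h1
    exact zero_ne_one h1
  rw [covariantAcceleration]
  congr 1
  ext i
  simp [sprayCoeff_eq hU hUk hc hne, h1]

end Finsler

open Asymptotics

/-! ### Minkowski energies: compactness and uniform estimates. -/

section Energy

variable {V : Type*} [NormedAddCommGroup V] [NormedSpace ℝ V]

/-- A function with the properties of half the square of a Minkowski norm (not necessarily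
reversible) of class `C³`. -/
structure IsMinkowskiEnergy (L : V → ℝ) : Prop where
  continuous : Continuous L
  map_zero : L 0 = 0
  contDiffAt : ∀ y, y ≠ 0 → ContDiffAt ℝ 3 L y
  euler : ∀ y, y ≠ 0 → fderiv ℝ L y y = 2 * L y
  pos : ∀ y, y ≠ 0 → ∀ v, v ≠ 0 → 0 < fderiv ℝ (fderiv ℝ L) y v v
  isBounded : Bornology.IsBounded {y | L y = 1 / 2}

variable {L : V → ℝ}

namespace IsMinkowskiEnergy

theorem ne_zero (hL : IsMinkowskiEnergy L) {z : V} (hz : L z = 1 / 2) : z ≠ 0 := by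
  rintro rfl
  rw [hL.map_zero] at hz
  norm_num at hz

theorem contDiffAt_two (hL : IsMinkowskiEnergy L) {y : V} (hy : y ≠ 0) : ContDiffAt ℝ 2 L y :=
  (hL.contDiffAt y hy).of_le (by norm_num)

theorem fderiv_fderiv_self (hL : IsMinkowskiEnergy L) {y : V} (hy : y ≠ 0) (u : V) :
    fderiv ℝ (fderiv ℝ L) y u y = fderiv ℝ L y u := by
  rw [fderiv_fderiv_apply_self_of_euler (k := 2) (hL.contDiffAt_two hy)]
  · ring
  · filter_upwards [isOpen_ne.mem_nhds hy] with z hz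
    exact hL.euler z hz

theorem fderiv_fderiv_self' (hL : IsMinkowskiEnergy L) {y : V} (hy : y ≠ 0) (u : V) :
    fderiv ℝ (fderiv ℝ L) y y u = fderiv ℝ L y u := by
  rw [fderiv_fderiv_comm (hL.contDiffAt_two hy), hL.fderiv_fderiv_self hy]

theorem contDiffAt_fderiv (hL : IsMinkowskiEnergy L) {y : V} (hy : y ≠ 0) :
    ContDiffAt ℝ 2 (fderiv ℝ L) y :=
  (hL.contDiffAt y hy).fderiv_right (by norm_num)

theorem contDiffAt_fderiv_fderiv (hL : IsMinkowskiEnergy L) {y : V} (hy : y ≠ 0) :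
    ContDiffAt ℝ 1 (fderiv ℝ (fderiv ℝ L)) y :=
  (hL.contDiffAt_fderiv hy).fderiv_right (by norm_num)

set_option maxSynthPendingDepth 4 in
theorem contDiffAt_fderiv_fderiv_fderiv (hL : IsMinkowskiEnergy L) {y : V} (hy : y ≠ 0) :
    ContDiffAt ℝ 0 (fderiv ℝ (fderiv ℝ (fderiv ℝ L))) y :=
  (hL.contDiffAt_fderiv_fderiv hy).fderiv_right (by norm_num)

end IsMinkowskiEnergy

end Energy

section Annulus

/-- The closed annulus `a ≤ ‖y‖ ≤ b`. -/
def annulus (V : Type*) [NormedAddCommGroup V] (a b : ℝ) : Set V := {y | a ≤ ‖y‖ ∧ ‖y‖ ≤ b}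

theorem isCompact_annulus {V : Type*} [NormedAddCommGroup V] [ProperSpace V] (a b : ℝ) : IsCompact (annulus V a b) := by
  refine Metric.isCompact_of_isClosed_isBounded ?_ ?_
  · exact (isClosed_le continuous_const continuous_norm).inter
      (isClosed_le continuous_norm continuous_const)
  · exact isBounded_iff_forall_norm_le.2 ⟨b, fun y hy => hy.2⟩

theorem exists_bound_on_annulus {V : Type*} [NormedAddCommGroup V] [ProperSpace V]
    {W : Type*} [NormedAddCommGroup W] {f : V → W}
    (hf : ∀ y, y ≠ 0 → ContinuousAt f y) {a : ℝ} (ha : 0 < a) (b : ℝ) :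
    ∃ K, 0 < K ∧ ∀ y ∈ annulus V a b, ‖f y‖ ≤ K := by
  obtain ⟨K, hK⟩ := (isCompact_annulus (V := V) a b).exists_bound_of_continuousOn (f := f)
    fun y hy => (hf y (norm_pos_iff.1 (ha.trans_le hy.1))).continuousWithinAt
  exact ⟨max K 1, by positivity, fun y hy => (hK y hy).trans (le_max_left _ _)⟩

end Annulus

namespace IsMinkowskiEnergy

variable {V : Type*} [NormedAddCommGroup V] [NormedSpace ℝ V] {L : V → ℝ}

/-- `L` is only assumed smooth off `0`, so the uniform constants need compact sets that avoid the
origin. -/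
theorem exists_annulus (hL : IsMinkowskiEnergy L) :
    ∃ a b, 0 < a ∧ ∀ z, L z = 1 / 2 → z ∈ annulus V a b := by
  obtain ⟨b, hb⟩ := isBounded_iff_forall_norm_le.1 hL.isBounded
  have h0 : ∀ᶠ y in 𝓝 (0 : V), L y < 1 / 2 :=
    hL.continuous.continuousAt.eventually (gt_mem_nhds (by rw [hL.map_zero]; norm_num))
  obtain ⟨a, ha, h⟩ := Metric.eventually_nhds_iff.1 h0
  refine ⟨a, b, ha, fun z hz => ⟨?_, hb z hz⟩⟩
  by_contra hcon
  have := h (show dist z 0 < a by simpa using hcon)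
  linarith

theorem exists_lower_bound [ProperSpace V] (hL : IsMinkowskiEnergy L) {a : ℝ} (ha : 0 < a)
    (b : ℝ) :
    ∃ m, 0 < m ∧ ∀ y ∈ annulus V a b, ∀ v, m * ‖v‖ ^ 2 ≤ fderiv ℝ (fderiv ℝ L) y v v := by
  set q : V × V → ℝ := fun p => fderiv ℝ (fderiv ℝ L) p.1 p.2 p.2
  have hne : ∀ p ∈ annulus V a b ×ˢ Metric.sphere (0 : V) 1, p.1 ≠ 0 ∧ p.2 ≠ 0 := by
    rintro ⟨y, v⟩ ⟨hy, hv⟩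
    refine ⟨norm_pos_iff.1 (ha.trans_le hy.1), norm_pos_iff.1 ?_⟩
    rw [mem_sphere_zero_iff_norm.1 hv]
    exact one_pos
  have hq : ∀ p ∈ annulus V a b ×ˢ Metric.sphere (0 : V) 1, 0 < q p := fun p hp =>
    hL.pos _ (hne p hp).1 _ (hne p hp).2
  -- Bounding `1 / q` from above, rather than taking a minimum of `q`, needs no nonemptiness.
  obtain ⟨C, hC⟩ := ((isCompact_annulus (V := V) a b).prod
    (isCompact_sphere (0 : V) 1)).exists_bound_of_continuousOn (f := fun p => (q p)⁻¹) (by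
      intro p hp
      refine (ContinuousAt.inv₀ ?_ (hq p hp).ne').continuousWithinAt
      have h1 : ContinuousAt (fun p : V × V => fderiv ℝ (fderiv ℝ L) p.1) p :=
        ContinuousAt.comp (g := fderiv ℝ (fderiv ℝ L))
          (hL.contDiffAt_fderiv_fderiv (hne p hp).1).continuousAt continuousAt_fst
      exact (h1.clm_apply continuousAt_snd).clm_apply continuousAt_snd)
  refine ⟨(max C 1)⁻¹, by positivity, fun y hy v => ?_⟩
  rcases eq_or_ne v 0 with rfl | hv
  · simp
  have hv' := norm_pos_iff.2 hv
  have hmem : (y, ‖v‖⁻¹ • v) ∈ annulus V a b ×ˢ Metric.sphere (0 : V) 1 := by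
    refine ⟨hy, ?_⟩
    rw [mem_sphere_zero_iff_norm, norm_smul, norm_inv, norm_norm, inv_mul_cancel₀ hv'.ne']
  have h1 := hq _ hmem
  have h2 := (hC _ hmem).trans (le_max_left _ 1)
  rw [norm_inv, Real.norm_of_nonneg h1.le] at h2
  have h3 : (max C 1)⁻¹ ≤ q (y, ‖v‖⁻¹ • v) := inv_le_of_inv_le₀ h1 h2
  have h4 : q (y, ‖v‖⁻¹ • v) * ‖v‖ ^ 2 = fderiv ℝ (fderiv ℝ L) y v v := by
    simp only [q, map_smul, smul_apply, smul_eq_mul]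
    field_simp
  rw [← h4]
  gcongr

set_option maxSynthPendingDepth 4 in
/-- Taylor expansions at the points of the unit level set, with uniform constants. -/
theorem exists_taylor_bounds [ProperSpace V] (hL : IsMinkowskiEnergy L) :
    ∃ K δ, 0 < K ∧ 0 < δ ∧ ∀ z, L z = 1 / 2 → ‖z‖ ≤ K ∧ ‖fderiv ℝ (fderiv ℝ L) z‖ ≤ K ∧
      ∀ b, ‖b‖ ≤ δ →
        ‖fderiv ℝ L (z + b) - fderiv ℝ L z - fderiv ℝ (fderiv ℝ L) z b‖ ≤ K * ‖b‖ ^ 2 ∧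
        |L (z + b) - L z - fderiv ℝ L z b - 1 / 2 * fderiv ℝ (fderiv ℝ L) z b b| ≤
          K * ‖b‖ ^ 3 := by
  obtain ⟨a, R, ha, hS⟩ := hL.exists_annulus
  obtain ⟨K₂, hK₂, hb₂⟩ := exists_bound_on_annulus (f := fderiv ℝ (fderiv ℝ L))
    (fun y hy => (hL.contDiffAt_fderiv_fderiv hy).continuousAt) ha R
  -- The annulus is widened by `a / 2` on both sides to contain the balls of radius `δ = a / 2`
  -- around the level set.
  obtain ⟨K₃, hK₃, hb₃⟩ := exists_bound_on_annulus (f := fderiv ℝ (fderiv ℝ (fderiv ℝ L)))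
    (fun y hy => (hL.contDiffAt_fderiv_fderiv_fderiv hy).continuousAt) (half_pos ha) (R + a / 2)
  refine ⟨max R (max K₂ K₃), a / 2, by positivity, by positivity, fun z hz =>
    ⟨(hS z hz).2.trans (le_max_left _ _),
      (hb₂ z (hS z hz)).trans ((le_max_left _ _).trans (le_max_right _ _)), fun b hb => ?_⟩⟩
  have hK₃le : K₃ ≤ max R (max K₂ K₃) := (le_max_right _ _).trans (le_max_right _ _)
  have hann : ∀ y ∈ Metric.closedBall z (a / 2), y ∈ annulus V (a / 2) (R + a / 2) := by
    intro y hy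
    rw [mem_closedBall_iff_norm] at hy
    have h1 := norm_sub_norm_le z y
    have h2 := norm_sub_norm_le y z
    rw [norm_sub_rev] at h1
    exact ⟨by linarith [(hS z hz).1], by linarith [(hS z hz).2]⟩
  have hne : ∀ y ∈ Metric.closedBall z (a / 2), y ≠ 0 := fun y hy =>
    norm_pos_iff.1 ((half_pos ha).trans_le (hann y hy).1)
  have hzmem : z ∈ Metric.closedBall z (a / 2) := Metric.mem_closedBall_self (half_pos ha).le
  have lip : ∀ y ∈ Metric.closedBall z (a / 2),
      ‖fderiv ℝ (fderiv ℝ L) y - fderiv ℝ (fderiv ℝ L) z‖ ≤ K₃ * ‖y - z‖ := fun y hy =>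
    (convex_closedBall z (a / 2)).norm_image_sub_le_of_norm_fderiv_le
      (fun x hx => (hL.contDiffAt_fderiv_fderiv (hne x hx)).differentiableAt (by norm_num))
      (fun x hx => hb₃ x (hann x hx)) hzmem hy
  have first : ∀ b, ‖b‖ ≤ a / 2 →
      ‖fderiv ℝ L (z + b) - fderiv ℝ L z - fderiv ℝ (fderiv ℝ L) z b‖ ≤ K₃ * ‖b‖ ^ 2 := by
    intro b hb
    have hsub : Metric.closedBall z ‖b‖ ⊆ Metric.closedBall z (a / 2) :=
      Metric.closedBall_subset_closedBall hb
    have := (convex_closedBall z ‖b‖).norm_image_sub_le_of_norm_hasFDerivWithin_le'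
      (f := fderiv ℝ L) (f' := fderiv ℝ (fderiv ℝ L)) (φ := fderiv ℝ (fderiv ℝ L) z)
      (C := K₃ * ‖b‖) (x := z) (y := z + b)
      (fun x hx => ((hL.contDiffAt_fderiv (hne x (hsub hx))).differentiableAt
        (by norm_num)).hasFDerivAt.hasFDerivWithinAt)
      (fun x hx => (lip x (hsub hx)).trans (by
        rw [mem_closedBall_iff_norm] at hx
        gcongr))
      (Metric.mem_closedBall_self (norm_nonneg _)) (by simp)
    rw [add_sub_cancel_left] at this
    calc _ ≤ _ := this
      _ = _ := by ring
  refine ⟨(first b hb).trans (by gcongr), ?_⟩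
  have hseg : ∀ t ∈ Icc (0 : ℝ) 1, ‖t • b‖ ≤ ‖b‖ := by
    intro t ht
    rw [norm_smul, Real.norm_of_nonneg ht.1]
    exact mul_le_of_le_one_left (norm_nonneg _) ht.2
  -- The `t`-derivative of this remainder is the first-order error at `t b` applied to `b`, so the
  -- cubic bound follows from `first`.
  have := norm_image_sub_le_of_norm_deriv_le_segment_01'
    (f := fun t : ℝ => L (z + t • b) - t * fderiv ℝ L z b
      - t ^ 2 * (1 / 2 * fderiv ℝ (fderiv ℝ L) z b b))
    (f' := fun t => fderiv ℝ L (z + t • b) b - fderiv ℝ L z b -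
      t * fderiv ℝ (fderiv ℝ L) z b b) (C := K₃ * ‖b‖ ^ 3) ?_ ?_
  · simp only [one_smul, zero_smul, add_zero, Real.norm_eq_abs] at this
    refine (le_of_eq ?_).trans (this.trans (by gcongr))
    congr 1
    ring
  · intro t ht
    have hmem : z + t • b ∈ Metric.closedBall z (a / 2) := by
      rw [mem_closedBall_iff_norm, add_sub_cancel_left]
      exact (hseg t ht).trans hb
    have h1 := hasDerivAt_comp_add_smul
      ((hL.contDiffAt _ (hne _ hmem)).differentiableAt (by norm_num))
    have h2 := (h1.sub ((hasDerivAt_id t).mul_const (fderiv ℝ L z b))).sub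
      (((hasDerivAt_id t).pow 2).mul_const (1 / 2 * fderiv ℝ (fderiv ℝ L) z b b))
    refine (HasDerivAt.congr_deriv h2 ?_).hasDerivWithinAt
    simp
    ring
  · intro t ht
    have hnorm := hseg t ⟨ht.1, ht.2.le⟩
    have h1 := first (t • b) (hnorm.trans hb)
    have h2 := ContinuousLinearMap.le_of_opNorm_le _ h1 b
    simp only [sub_apply, map_smul, smul_apply, smul_eq_mul] at h2
    refine h2.trans ?_
    calc K₃ * ‖t • b‖ ^ 2 * ‖b‖ ≤ K₃ * ‖b‖ ^ 2 * ‖b‖ := by gcongr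
      _ = K₃ * ‖b‖ ^ 3 := by ring

/-- Uniform strict convexity of the unit level set. -/
theorem exists_strict_convexity [ProperSpace V] (hL : IsMinkowskiEnergy L) :
    ∃ m, 0 < m ∧ ∀ z w, L z = 1 / 2 → L w = 1 / 2 → 1 / 2 ≤ fderiv ℝ L z w →
      m * ‖w - z‖ ^ 2 ≤ -fderiv ℝ L z (w - z) := by
  obtain ⟨a, R, ha, hS⟩ := hL.exists_annulus
  obtain ⟨K, hK, hb⟩ := exists_bound_on_annulus (f := fderiv ℝ L)
    (fun y hy => (hL.contDiffAt_fderiv hy).continuousAt) ha R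
  -- The form `DL(z)`, of norm at most `K`, is at least `1 / 2` at `z` and at `w`, hence on the
  -- whole segment; so the segment stays at distance at least `1 / (2K)` from the origin.
  obtain ⟨m, hm, hlow⟩ := hL.exists_lower_bound (a := 1 / (2 * K)) (by positivity) R
  refine ⟨m / 2, by positivity, fun z w hz hw hzw => ?_⟩
  set h := w - z
  have hann : ∀ t ∈ Icc (0 : ℝ) 1, z + t • h ∈ annulus V (1 / (2 * K)) R := by
    intro t ht
    have heq : z + t • h = (1 - t) • z + t • w := by simp only [h]; module
    constructor
    · have h1 : 1 / 2 ≤ fderiv ℝ L z (z + t • h) := by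
        rw [heq, map_add, map_smul, map_smul, hL.euler z (hL.ne_zero hz), hz, smul_eq_mul,
          smul_eq_mul]
        nlinarith [ht.1, ht.2]
      have h2 := (le_abs_self _).trans (ContinuousLinearMap.le_of_opNorm_le _ (hb z (hS z hz))
        (z + t • h))
      rw [div_le_iff₀ (by positivity)]
      linarith
    · have := convex_closedBall (0 : V) R (mem_closedBall_zero_iff.2 (hS z hz).2)
        (mem_closedBall_zero_iff.2 (hS w hw).2) (sub_nonneg.2 ht.2) ht.1 (by ring)
      rw [← heq] at this
      exact mem_closedBall_zero_iff.1 this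
  have hne : ∀ t ∈ Icc (0 : ℝ) 1, z + t • h ≠ 0 := fun t ht =>
    norm_pos_iff.1 (lt_of_lt_of_le (by positivity) (hann t ht).1)
  -- The bound `D²L(h, h) ≥ m ‖h‖²` is integrated twice along the segment; `ψ` and `φ` are the two
  -- monotone functions.
  set ψ : ℝ → ℝ := fun t => fderiv ℝ L (z + t • h) h - fderiv ℝ L z h - t * (m * ‖h‖ ^ 2)
  have hψ : ∀ t ∈ Icc (0 : ℝ) 1,
      HasDerivAt ψ (fderiv ℝ (fderiv ℝ L) (z + t • h) h h - m * ‖h‖ ^ 2) t := by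
    intro t ht
    have h1 := (hasDerivAt_comp_add_smul ((hL.contDiffAt_fderiv (hne t ht)).differentiableAt
      (by norm_num))).clm_apply (hasDerivAt_const t h)
    have h2 := (h1.sub_const (fderiv ℝ L z h)).sub ((hasDerivAt_id t).mul_const (m * ‖h‖ ^ 2))
    refine HasDerivAt.congr_deriv (f := ψ) h2 ?_
    simp
  have hψmono : MonotoneOn ψ (Icc 0 1) :=
    monotoneOn_of_hasDerivWithinAt_nonneg (convex_Icc 0 1)
      (fun t ht => (hψ t ht).continuousAt.continuousWithinAt)
      (fun t ht => (hψ t (interior_subset ht)).hasDerivWithinAt)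
      (fun t ht => sub_nonneg.2 (hlow _ (hann t (interior_subset ht)) h))
  have hψ0 : ∀ t ∈ Icc (0 : ℝ) 1, 0 ≤ ψ t := by
    intro t ht
    have := hψmono (left_mem_Icc.2 zero_le_one) ht ht.1
    simpa [ψ] using this
  set φ : ℝ → ℝ := fun t => L (z + t • h) - t * fderiv ℝ L z h - t ^ 2 * (m / 2 * ‖h‖ ^ 2)
  have hφ : ∀ t ∈ Icc (0 : ℝ) 1, HasDerivAt φ (ψ t) t := by
    intro t ht
    have h1 := hasDerivAt_comp_add_smul
      ((hL.contDiffAt _ (hne t ht)).differentiableAt (by norm_num))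
    have h2 := (h1.sub ((hasDerivAt_id t).mul_const (fderiv ℝ L z h))).sub
      (((hasDerivAt_id t).pow 2).mul_const (m / 2 * ‖h‖ ^ 2))
    refine HasDerivAt.congr_deriv (f := φ) h2 ?_
    simp [ψ]
    ring
  have hφmono : MonotoneOn φ (Icc 0 1) :=
    monotoneOn_of_hasDerivWithinAt_nonneg (convex_Icc 0 1)
      (fun t ht => (hφ t ht).continuousAt.continuousWithinAt)
      (fun t ht => (hφ t (interior_subset ht)).hasDerivWithinAt)
      (fun t ht => hψ0 t (interior_subset ht))
  have hfin := hφmono (left_mem_Icc.2 zero_le_one) (right_mem_Icc.2 zero_le_one) zero_le_one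
  have hzh : z + h = w := by simp [h]
  simp only [φ, zero_smul, add_zero, one_smul, hzh, hz, hw] at hfin
  linarith

end IsMinkowskiEnergy

/-! ### Calculus of orders in `s = √ε`. -/

section BigO

variable {X V : Type*} [NormedAddCommGroup V] {l : Filter X} {s : X → ℝ}

theorem isBigO_pow_of_le (hs : Tendsto s l (𝓝 0)) {j k : ℕ} (hjk : j ≤ k) :
    (fun x => s x ^ k) =O[l] fun x => s x ^ j := by
  have h1 : ∀ᶠ x in l, |s x| ≤ 1 :=
    (hs.abs.eventually (gt_mem_nhds (by simp))).mono fun _ h => le_of_lt h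
  refine IsBigO.of_bound 1 ?_
  filter_upwards [h1] with x hx
  rw [one_mul, norm_pow, norm_pow]
  exact pow_le_pow_of_le_one (norm_nonneg _) hx hjk

theorem IsBigO.mul_pow_add {f g : X → ℝ} {j k : ℕ} (hf : f =O[l] fun x => s x ^ j)
    (hg : g =O[l] fun x => s x ^ k) : (fun x => f x * g x) =O[l] fun x => s x ^ (j + k) := by
  simpa only [pow_add] using hf.mul hg

theorem IsBigO.smul_pow_add [NormedSpace ℝ V] {f : X → ℝ} {g : X → V} {j k : ℕ}
    (hf : f =O[l] fun x => s x ^ j) (hg : g =O[l] fun x => s x ^ k) :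
    (fun x => f x • g x) =O[l] fun x => s x ^ (j + k) := by
  simpa only [pow_add, smul_eq_mul] using hf.smul hg

theorem isBigO_of_norm_le_pow {W : Type*} [NormedAddCommGroup W] {f : X → W} {g : X → V} {K : ℝ}
    {j : ℕ} (hfg : ∀ᶠ x in l, ‖f x‖ ≤ K * ‖g x‖ ^ j) (hg : g =O[l] s) :
    f =O[l] fun x => s x ^ j := by
  refine IsBigO.trans (IsBigO.of_bound K ?_) (hg.norm_left.pow j)
  filter_upwards [hfg] with x hx
  simpa using hx

end BigO

/-! ### Expansion of the energy along the acceleration ray. -/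

namespace IsMinkowskiEnergy

variable {V : Type*} [NormedAddCommGroup V] [NormedSpace ℝ V] [ProperSpace V] {L : V → ℝ}

/-- Let `z` and `w = (1 - ε) z + τ` lie on the unit level set of `L`, `τ` being tangent at `z`, and
let `a = α τ + β z` be tangent at `w` with `(1 - ε) β = -D²L(z)(τ, τ)`.  Then the function `L`
along the ray from `(1 - ε) z` in the direction `a` is `1/2 + ε (T² - 2 T - 1)` up to
`O(ε^{3/2})`. -/
theorem isBigO_ray (hL : IsMinkowskiEnergy L) {X : Type*} {l : Filter X} {z τ : X → V}
    {ε α β T : X → ℝ} (hε : Tendsto ε l (𝓝 0)) (hε0 : ∀ x, 0 < ε x)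
    (hT : ∀ x, |T x| ≤ 4) (hz : ∀ x, L (z x) = 1 / 2)
    (hτ : ∀ x, fderiv ℝ L (z x) (τ x) = 0)
    (hw : ∀ x, L ((1 - ε x) • z x + τ x) = 1 / 2)
    (ha : ∀ x, fderiv ℝ L ((1 - ε x) • z x + τ x) (α x • τ x + β x • z x) = 0)
    (hβ : ∀ x, (1 - ε x) * β x = -fderiv ℝ (fderiv ℝ L) (z x) (τ x) (τ x)) :
    (fun x => L ((1 - ε x) • z x + T x • (α x • τ x + β x • z x)) - 1 / 2
      - ε x * (T x ^ 2 - 2 * T x - 1)) =O[l] fun x => √(ε x) ^ 3 := by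
  obtain ⟨K, δ, hK, hδ, htaylor⟩ := hL.exists_taylor_bounds
  obtain ⟨m, hm, hconv⟩ := hL.exists_strict_convexity
  set s : X → ℝ := fun x => √(ε x)
  have hs0 : ∀ x, 0 < s x := fun x => Real.sqrt_pos.2 (hε0 x)
  have hεs : ∀ x, ε x = s x ^ 2 := fun x => (Real.sq_sqrt (hε0 x).le).symm
  have hs : Tendsto s l (𝓝 0) := by simpa using hε.sqrt
  have hpow {j k : ℕ} (h : j ≤ k) := isBigO_pow_of_le hs h
  have hsmall : ∀ᶠ x in l, ε x < 1 / 2 := hε.eventually (gt_mem_nhds (by norm_num))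
  have Oε : ε =O[l] fun x => s x ^ 2 := by
    rw [show ε = fun x => s x ^ 2 from funext hεs]
  have Oz : z =O[l] fun x => s x ^ 0 :=
    IsBigO.of_bound K (Eventually.of_forall fun x => by simpa using (htaylor _ (hz x)).1)
  have OT : T =O[l] fun x => s x ^ 0 :=
    IsBigO.of_bound 4 (Eventually.of_forall fun x => by simpa using hT x)
  have hzne := fun x => hL.ne_zero (hz x)
  have hDz : ∀ x, fderiv ℝ L (z x) (z x) = 1 := fun x => by
    rw [hL.euler _ (hzne x), hz x]; norm_num
  have hD2z : ∀ x u, fderiv ℝ (fderiv ℝ L) (z x) u (z x) = fderiv ℝ L (z x) u := fun x =>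
    hL.fderiv_fderiv_self (hzne x)
  have hD2z' : ∀ x u, fderiv ℝ (fderiv ℝ L) (z x) (z x) u = fderiv ℝ L (z x) u := fun x =>
    hL.fderiv_fderiv_self' (hzne x)
  set w : X → V := fun x => (1 - ε x) • z x + τ x
  set h : X → V := fun x => τ x - ε x • z x
  have hwh : ∀ x, z x + h x = w x := fun x => by simp only [h, w]; module
  have hDzh : ∀ x, fderiv ℝ L (z x) (h x) = -ε x := fun x => by
    simp only [h, map_sub, map_smul, hτ, hDz, smul_eq_mul]; ring
  -- Strict convexity reads `m ‖h‖² ≤ -DL(z)(h) = ε`.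
  have Oh : h =O[l] s := by
    refine IsBigO.of_bound (√(m⁻¹)) ?_
    filter_upwards [hsmall] with x hx
    have h1 := hconv _ _ (hz x) (hw x) (by
      simp only [map_add, map_smul, hτ, hDz, smul_eq_mul]; linarith)
    have hwz : (1 - ε x) • z x + τ x - z x = h x := by simp only [h]; module
    rw [hwz, hDzh, neg_neg] at h1
    rw [Real.norm_of_nonneg (hs0 x).le, ← Real.sqrt_mul (inv_pos.2 hm).le]
    refine Real.le_sqrt_of_sq_le ?_
    rw [inv_mul_eq_div, le_div_iff₀ hm]
    linarith
  have hsmall_of {g : X → V} (hg : g =O[l] s) : ∀ᶠ x in l, ‖g x‖ ≤ δ := by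
    have := (hg.trans_tendsto hs).norm
    rw [norm_zero] at this
    exact (this.eventually (gt_mem_nhds hδ)).mono fun _ h => le_of_lt h
  have Oεz : (fun x => ε x • z x) =O[l] s := by
    have := (IsBigO.smul_pow_add Oε Oz).trans (hpow (show 1 ≤ 2 + 0 by norm_num))
    simpa only [pow_one] using this
  have Oτ : τ =O[l] s := by
    have : τ = fun x => h x + ε x • z x := by ext x; simp [h]
    rw [this]
    exact Oh.add Oεz
  set Q : X → ℝ := fun x => fderiv ℝ (fderiv ℝ L) (z x) (τ x) (τ x)
  have OQ : Q =O[l] fun x => s x ^ 2 := by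
    refine isBigO_of_norm_le_pow (K := K) (g := τ) (Eventually.of_forall fun x => ?_) Oτ
    refine (ContinuousLinearMap.le_opNorm₂ _ _ _).trans ?_
    calc _ ≤ K * ‖τ x‖ * ‖τ x‖ := by gcongr; exact (htaylor _ (hz x)).2.1
      _ = _ := by ring
  -- Taylor at `z` with `L(z + h) = L(z)`, `DL(z)(h) = -ε` and `D²L(z)(h, h) = Q + ε²`.
  have OQ2 : (fun x => Q x - 2 * ε x) =O[l] fun x => s x ^ 3 := by
    have h1 : (fun x => L (z x + h x) - L (z x) - fderiv ℝ L (z x) (h x)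
        - 1 / 2 * fderiv ℝ (fderiv ℝ L) (z x) (h x) (h x)) =O[l] fun x => s x ^ 3 :=
      isBigO_of_norm_le_pow (K := K) (g := h)
        ((hsmall_of Oh).mono fun x hx => ((htaylor _ (hz x)).2.2 _ hx).2) Oh
    have h2 : (fun x => ε x * ε x) =O[l] fun x => s x ^ 3 :=
      (IsBigO.mul_pow_add Oε Oε).trans (hpow (by norm_num))
    refine ((h1.const_mul_left (-2)).sub h2).congr_left fun x => ?_
    rw [hDzh, hwh, show L (w x) = 1 / 2 from hw x, hz]
    simp only [h, map_sub, map_smul, sub_apply, smul_apply, hD2z, hD2z', hτ, hDz, smul_eq_mul, Q]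
    ring
  set A : X → ℝ := fun x => fderiv ℝ L (w x) (τ x)
  set B : X → ℝ := fun x => fderiv ℝ L (w x) (z x)
  have ODL : (fun x => fderiv ℝ L (z x + h x) - fderiv ℝ L (z x)
      - fderiv ℝ (fderiv ℝ L) (z x) (h x)) =O[l] fun x => s x ^ 2 :=
    isBigO_of_norm_le_pow (K := K) (g := h)
      ((hsmall_of Oh).mono fun x hx => ((htaylor _ (hz x)).2.2 _ hx).1) Oh
  have Oapply {u : X → V} {k : ℕ} (hu : u =O[l] fun x => s x ^ k) :
      (fun x => (fderiv ℝ L (z x + h x) - fderiv ℝ L (z x)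
        - fderiv ℝ (fderiv ℝ L) (z x) (h x)) (u x)) =O[l] fun x => s x ^ (2 + k) := by
    refine IsBigO.trans (IsBigO.of_norm_le fun x => ?_)
      (IsBigO.mul_pow_add ODL.norm_left hu.norm_left)
    exact ContinuousLinearMap.le_opNorm _ _
  have OA : (fun x => A x - Q x) =O[l] fun x => s x ^ 3 := by
    refine (Oapply (u := τ) (k := 1) (by simpa using Oτ)).congr_left fun x => ?_
    rw [hwh]
    simp only [sub_apply, h, map_sub, map_smul, smul_apply, hD2z', hτ, smul_eq_mul, A, Q]
    ring
  have OB : (fun x => B x - 1) =O[l] fun x => s x ^ 1 := by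
    have h1 := (Oapply Oz).trans (hpow (show 1 ≤ 2 + 0 by norm_num))
    refine (h1.sub (Oε.trans (hpow (show 1 ≤ 2 by norm_num)))).congr_left fun x => ?_
    rw [hwh]
    simp only [sub_apply, hD2z, hDzh, hDz, B]
    ring
  -- Tangency at `w` is `α A + β B = 0`; with `(1 - ε) β = -Q`, `A ≈ Q` and `B ≈ 1` it will force `α
  -- ≈ 1`.
  have hAB : ∀ x, (1 - ε x) * α x * A x = Q x * B x := fun x => by
    have h1 := ha x
    rw [map_add, map_smul, map_smul, smul_eq_mul, smul_eq_mul] at h1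
    linear_combination (1 - ε x) * h1 - B x * hβ x
  -- Since `(1 - ε) A = 2ε + O(s³)`, this factor has exact order `s²` and can be divided out to
  -- bound `α - 1`.
  have hAlow : ∀ᶠ x in l, ε x ≤ (1 - ε x) * A x := by
    have h1 : (fun x => (1 - ε x) * A x - 2 * ε x) =O[l] fun x => s x ^ 3 := by
      have hOA : A =O[l] fun x => s x ^ 2 :=
        ((OA.trans (hpow (by norm_num))).add OQ).congr_left fun x => by ring
      refine ((OA.add OQ2).sub ((IsBigO.mul_pow_add Oε hOA).trans
        (hpow (show 3 ≤ 2 + 2 by norm_num)))).congr_left fun x => by ring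
    have h2 : (fun x => s x ^ 3) =o[l] fun x => s x ^ 2 := by
      have := (isBigO_refl (fun x => s x ^ 2) l).mul_isLittleO
        ((isLittleO_one_iff ℝ).2 hs)
      exact this.congr (fun x => by ring) (fun x => by ring)
    filter_upwards [(h1.trans_isLittleO h2).bound one_pos] with x hx
    rw [Real.norm_eq_abs, Real.norm_of_nonneg (by positivity), one_mul, ← hεs] at hx
    linarith [(abs_le.1 hx).1]
  have Oα : (fun x => α x - 1) =O[l] fun x => s x ^ 1 := by
    have h1 : (fun x => (1 - ε x) * A x * (α x - 1)) =O[l] fun x => s x ^ 3 := by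
      have hOA : A =O[l] fun x => s x ^ 2 :=
        ((OA.trans (hpow (by norm_num))).add OQ).congr_left fun x => by ring
      have h2 := IsBigO.mul_pow_add OQ OB
      have h3 := (IsBigO.mul_pow_add Oε hOA).trans (hpow (show 3 ≤ 2 + 2 by norm_num))
      refine ((h2.sub OA).add h3).congr_left fun x => ?_
      linear_combination -hAB x
    obtain ⟨C, hC⟩ := h1.bound
    refine IsBigO.of_bound C ?_
    filter_upwards [hC, hAlow] with x hx hx'
    have hsx := hs0 x
    rw [norm_mul, Real.norm_of_nonneg ((hε0 x).le.trans hx'), Real.norm_of_nonneg (show 0 ≤ s x ^ 3 by positivity)] at hx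
    rw [Real.norm_of_nonneg (show 0 ≤ s x ^ 1 by positivity)]
    have h2 : s x ^ 2 * ‖α x - 1‖ ≤ s x ^ 2 * (C * s x ^ 1) :=
      calc s x ^ 2 * ‖α x - 1‖ ≤ (1 - ε x) * A x * ‖α x - 1‖ := by
            rw [← hεs]; gcongr
        _ ≤ C * s x ^ 3 := hx
        _ = _ := by ring
    exact le_of_mul_le_mul_left h2 (by positivity)
  have O_one : (fun _ => (1 : ℝ)) =O[l] fun x => s x ^ 0 :=
    (isBigO_refl (fun _ => (1 : ℝ)) l).congr_right fun x => (pow_zero _).symm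
  have Oα0 : α =O[l] fun x => s x ^ 0 := by
    exact ((Oα.trans (hpow (by norm_num))).add O_one).congr_left fun x => by ring
  have Oβ : β =O[l] fun x => s x ^ 2 := by
    refine IsBigO.trans (IsBigO.of_bound 2 ?_) OQ
    filter_upwards [hsmall] with x hx
    have h1 := congrArg abs (hβ x)
    rw [abs_mul, abs_neg, abs_of_pos (show 0 < 1 - ε x by linarith)] at h1
    rw [Real.norm_eq_abs, Real.norm_eq_abs]
    simp only [Q]
    nlinarith [abs_nonneg (β x)]
  have Oβ2 : (fun x => β x + 2 * ε x) =O[l] fun x => s x ^ 3 := by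
    refine (((IsBigO.mul_pow_add Oε Oβ).trans (hpow (show 3 ≤ 2 + 2 by norm_num))).sub
      OQ2).congr_left fun x => ?_
    linear_combination -hβ x
  -- Here `DL(z)(b) = T β - ε` and `D²L(z)(b, b) = T² α² Q + (T β - ε)²`; inserting `β ≈ -2ε`, `Q ≈
  -- 2ε`, `α ≈ 1` leaves `ε (T² - 2T - 1)`.
  set b : X → V := fun x => T x • (α x • τ x + β x • z x) - ε x • z x
  have Ob : b =O[l] s := by
    have h1 : (fun x => α x • τ x) =O[l] fun x => s x ^ 1 :=
      IsBigO.smul_pow_add (j := 0) (k := 1) Oα0 (by simpa using Oτ)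
    have h2 : (fun x => β x • z x) =O[l] fun x => s x ^ 1 :=
      (IsBigO.smul_pow_add Oβ Oz).trans (hpow (by norm_num))
    have h3 := IsBigO.smul_pow_add OT (h1.add h2)
    simp only [zero_add, pow_one] at h3
    exact h3.sub Oεz
  have hzb : ∀ x, (1 - ε x) • z x + T x • (α x • τ x + β x • z x) = z x + b x := fun x => by
    simp only [b]; module
  have hmain : (fun x => L (z x + b x) - L (z x) - fderiv ℝ L (z x) (b x)
      - 1 / 2 * fderiv ℝ (fderiv ℝ L) (z x) (b x) (b x)) =O[l] fun x => s x ^ 3 :=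
    isBigO_of_norm_le_pow (K := K) (g := b)
      ((hsmall_of Ob).mono fun x hx => ((htaylor _ (hz x)).2.2 _ hx).2) Ob
  have O1 : (fun x => T x * (β x + 2 * ε x)) =O[l] fun x => s x ^ 3 := by
    simpa only [zero_add] using IsBigO.mul_pow_add OT Oβ2
  have O2 : (fun x => (α x * α x - 1) * Q x + (Q x - 2 * ε x)) =O[l] fun x => s x ^ 3 := by
    have h1 : (fun x => α x + 1) =O[l] fun x => s x ^ 0 :=
      Oα0.add O_one
    refine ((IsBigO.mul_pow_add (IsBigO.mul_pow_add Oα h1) OQ).add OQ2).congr_left fun x => ?_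
    ring
  have O3 : (fun x => T x * T x * ((α x * α x - 1) * Q x + (Q x - 2 * ε x))) =O[l]
      fun x => s x ^ 3 := by
    simpa only [zero_add] using IsBigO.mul_pow_add (IsBigO.mul_pow_add OT OT) O2
  have O4 : (fun x => (T x * β x - ε x) * (T x * β x - ε x)) =O[l] fun x => s x ^ 3 := by
    have h1 : (fun x => T x * β x - ε x) =O[l] fun x => s x ^ 2 := by
      have := IsBigO.mul_pow_add OT Oβ
      simp only [zero_add] at this
      exact this.sub Oε
    exact (IsBigO.mul_pow_add h1 h1).trans (hpow (by norm_num))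
  refine (((hmain.add O1).add (O3.const_mul_left (1 / 2))).add
    (O4.const_mul_left (1 / 2))).congr_left fun x => ?_
  rw [hzb, hz]
  simp only [b, map_sub, map_add, map_smul, sub_apply, add_apply, smul_apply, hD2z, hD2z', hτ, hDz,
    smul_eq_mul, Q]
  ring

end IsMinkowskiEnergy

/-- Uniformity is obtained by applying `isBigO_ray` to the type of all admissible data, filtered by
`ε → 0` alone: its one implied constant then serves all of them. -/
theorem IsMinkowskiEnergy.exists_ray_bound {V : Type*} [NormedAddCommGroup V] [NormedSpace ℝ V]
    [ProperSpace V] {L : V → ℝ} (hL : IsMinkowskiEnergy L) :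
    ∃ K ε₀ : ℝ, 0 < K ∧ 0 < ε₀ ∧ ∀ (z τ : V) (ε α β T : ℝ), 0 < ε → ε < ε₀ → |T| ≤ 4 →
      L z = 1 / 2 → fderiv ℝ L z τ = 0 → L ((1 - ε) • z + τ) = 1 / 2 →
      fderiv ℝ L ((1 - ε) • z + τ) (α • τ + β • z) = 0 →
      (1 - ε) * β = -fderiv ℝ (fderiv ℝ L) z τ τ →
      |L ((1 - ε) • z + T • (α • τ + β • z)) - 1 / 2 - ε * (T ^ 2 - 2 * T - 1)| ≤ K * √ε ^ 3 := by
  let X := {p : V × V × ℝ × ℝ × ℝ × ℝ // 0 < p.2.2.1 ∧ |p.2.2.2.2.2| ≤ 4 ∧ L p.1 = 1 / 2 ∧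
    fderiv ℝ L p.1 p.2.1 = 0 ∧ L ((1 - p.2.2.1) • p.1 + p.2.1) = 1 / 2 ∧
    fderiv ℝ L ((1 - p.2.2.1) • p.1 + p.2.1) (p.2.2.2.1 • p.2.1 + p.2.2.2.2.1 • p.1) = 0 ∧
    (1 - p.2.2.1) * p.2.2.2.2.1 = -fderiv ℝ (fderiv ℝ L) p.1 p.2.1 p.2.1}
  have hO := hL.isBigO_ray (X := X) (l := comap (fun p : X => p.1.2.2.1) (𝓝 0))
    (z := fun p => p.1.1) (τ := fun p => p.1.2.1) (ε := fun p => p.1.2.2.1)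
    (α := fun p => p.1.2.2.2.1) (β := fun p => p.1.2.2.2.2.1) (T := fun p => p.1.2.2.2.2.2)
    tendsto_comap (fun p => p.2.1) (fun p => p.2.2.1) (fun p => p.2.2.2.1) (fun p => p.2.2.2.2.1)
    (fun p => p.2.2.2.2.2.1) (fun p => p.2.2.2.2.2.2.1) (fun p => p.2.2.2.2.2.2.2)
  obtain ⟨K, hK, hb⟩ := hO.exists_pos
  obtain ⟨ε₀, hε₀, h⟩ := Metric.eventually_nhds_iff.1 (eventually_comap.1 hb.bound)
  refine ⟨K, ε₀, hK, hε₀, fun z τ ε α β T h1 h2 h3 h4 h5 h6 h7 h8 => ?_⟩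
  have := h (show dist ε 0 < ε₀ by rwa [dist_zero_right, Real.norm_of_nonneg h1.le])
    ⟨(z, τ, ε, α, β, T), h1, h3, h4, h5, h6, h7, h8⟩ rfl
  rwa [Real.norm_eq_abs, Real.norm_of_nonneg (by positivity)] at this

/-- If `1 / k` is the root near `1 + √2` of a perturbation of `T² - 2 T - 1`, then `k` is close to
`√2 - 1`. -/
theorem abs_sub_sqrt_two_sub_one_le {f : ℝ → ℝ} {k K s : ℝ} (hk : 0 ≤ k) (hs : 0 < s) (hK : 0 < K)
    (hKs : K * s ≤ 1 / 2) (hf : ∀ T, |T| ≤ 4 → |f T - 1 / 2 - s ^ 2 * (T ^ 2 - 2 * T - 1)| ≤ K * s ^ 3)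
    (hfk : ∀ T, 0 < T → (T * k < 1 ↔ f T < 1 / 2)) : |k - (√2 - 1)| ≤ K * s := by
  have h2 : √2 * √2 = 2 := Real.mul_self_sqrt (by norm_num)
  have hlow : 1.4 < √2 := Real.lt_sqrt_of_sq_lt (by norm_num)
  have hup : √2 < 1.5 := (Real.sqrt_lt' (by norm_num)).2 (by norm_num)
  have hp : 0 < K * s := by positivity
  set d := K * s
  have hs2 : 0 < s ^ 2 := by positivity
  have hKs3 : K * s ^ 3 = s ^ 2 * d := by simp only [d]; ring
  -- At `T = 1 + √2 ± d` the quadratic equals `±2√2 d + d²`, which for `0 < d ≤ 1/2` lies beyond the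
  -- error `±d`; so `1 / k` is caught between these two values.
  have hT1 : (1 + √2 - d) * k < 1 := by
    rw [hfk _ (by linarith)]
    have h := (abs_le.1 (hf (1 + √2 - d) (by rw [abs_le]; constructor <;> linarith))).2
    have h' : (1 + √2 - d) ^ 2 - 2 * (1 + √2 - d) - 1 < -d := by nlinarith
    have := mul_lt_mul_of_pos_left h' hs2
    linarith
  have hT2 : 1 ≤ (1 + √2 + d) * k := by
    rw [← not_lt, hfk _ (by linarith), not_lt]
    have h := (abs_le.1 (hf (1 + √2 + d) (by rw [abs_le]; constructor <;> linarith))).1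
    have h' : d < (1 + √2 + d) ^ 2 - 2 * (1 + √2 + d) - 1 := by nlinarith
    have := mul_lt_mul_of_pos_left h' hs2
    linarith
  have hk1 : k ≤ 1 := by nlinarith
  have hdk : d * k ≤ d := mul_le_of_le_one_right hp.le hk1
  rw [abs_le]
  constructor <;> nlinarith

/-! ### Arc length parametrized Funk circles and their curvature. -/

section Curves

variable {n : ℕ} {U : Set (E n)}

theorem isMinkowskiEnergy_funkEnergy (hU : IsFunkDomain U) (hUk : HasPositivelyCurvedC3Boundary U)
    {o : E n} (ho : o ∈ U) : IsMinkowskiEnergy (funkEnergy U o) where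
  continuous := continuous_const.mul ((continuous_funkMetric hU ho).pow 2)
  map_zero := by simp [funkEnergy, funkMetric_zero]
  contDiffAt _ hy := contDiffAt_funkEnergy hU hUk ho hy
  euler _ hy := fderiv_funkEnergy_self hU hUk ho hy
  pos _ hy _ hv := fderiv_fderiv_funkEnergy_pos hU hUk ho hy hv
  isBounded := by
    obtain ⟨C, hC⟩ := isBounded_iff_forall_norm_le.1 hU.isBounded.closure
    refine isBounded_iff_forall_norm_le.2 ⟨C + ‖o‖, fun y hy => ?_⟩
    have h1 : funkMetric U o y = 1 := by
      have h : 1 / 2 * funkMetric U o y ^ 2 = 1 / 2 := hy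
      have h0 := funkMetric_nonneg (U := U) o y
      nlinarith
    have h2 := hC _ (frontier_subset_closure ((funkMetric_eq_one_iff hU ho y).1 h1))
    have h := norm_sub_le (o + y) o
    rw [add_sub_cancel_left] at h
    linarith

theorem funkEnergy_eq_half {o y : E n} (h : funkMetric U o y = 1) :
    funkEnergy U o y = 1 / 2 := by
  rw [funkEnergy, h]; norm_num

theorem funkEnergy_lt_half_iff (hU : IsFunkDomain U) {o : E n} (ho : o ∈ U) (y : E n) :
    funkEnergy U o y < 1 / 2 ↔ o + y ∈ U := by
  rw [← funkMetric_lt_one_iff hU ho, funkEnergy]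
  have h0 := funkMetric_nonneg (U := U) o y
  constructor <;> intro h <;> nlinarith

theorem hasDerivAt_mem_submodule {P : Submodule ℝ (E n)} {f : ℝ → E n} {f' o : E n} {s : ℝ}
    (hf : HasDerivAt f f' s) (hP : ∀ᶠ t in 𝓝 s, f t - o ∈ P) : f' ∈ P := by
  have hcl : IsClosed (P : Set (E n)) := P.closed_of_finiteDimensional
  refine hcl.mem_of_tendsto (hasDerivAt_iff_tendsto_slope.1 hf) ?_
  filter_upwards [hP.filter_mono nhdsWithin_le_nhds] with t ht
  rw [slope_def_module]
  refine P.smul_mem _ ?_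
  simpa using P.sub_mem ht hP.self_of_nhds

theorem exists_eq_add_smul_of_finrank_eq_two {V : Type*} [AddCommGroup V] [Module ℝ V]
    {P : Submodule ℝ V} (hP : Module.finrank ℝ P = 2) {u v a : V} (hu : u ∈ P) (hv : v ∈ P)
    (huv : LinearIndependent ℝ ![u, v]) (ha : a ∈ P) : ∃ α β : ℝ, a = α • u + β • v := by
  have : FiniteDimensional ℝ P := Module.finite_of_finrank_eq_succ hP
  have hle : Submodule.span ℝ {u, v} ≤ P := by
    rw [Submodule.span_le]
    rintro _ (rfl | rfl) <;> assumption
  have hfr : Module.finrank ℝ (Submodule.span ℝ {u, v}) = 2 := by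
    rw [← Matrix.range_cons_cons_empty u v ![]]
    exact finrank_span_eq_card huv
  have heq := Submodule.eq_of_le_of_finrank_eq hle (hfr.trans hP.symm)
  rw [← heq, Submodule.mem_span_pair] at ha
  obtain ⟨α, β, h⟩ := ha
  exact ⟨α, β, h.symm⟩

/-- First and second order data of an arc length parametrized Funk circle. -/
theorem exists_tangent_data (hU : IsFunkDomain U) (hUk : HasPositivelyCurvedC3Boundary U)
    {o : E n} (ho : o ∈ U) {r : ℝ} (hr : 0 < r) {P : Submodule ℝ (E n)}
    (hP : Module.finrank ℝ P = 2) {c : ℝ → E n} {s : ℝ}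
    (hc : IsArcLengthParamAt (funkMetric U) (funkCircle U o P r) c s) :
    ∃ (z τ : E n) (α β : ℝ), c s = o + (1 - Real.exp (-r)) • z ∧
      covariantAcceleration (funkMetric U) c s = α • τ + β • z ∧
      funkEnergy U o z = 1 / 2 ∧ fderiv ℝ (funkEnergy U o) z τ = 0 ∧
      funkEnergy U o ((1 - Real.exp (-r)) • z + τ) = 1 / 2 ∧
      fderiv ℝ (funkEnergy U o) ((1 - Real.exp (-r)) • z + τ) (α • τ + β • z) = 0 ∧
      (1 - Real.exp (-r)) * β = -fderiv ℝ (fderiv ℝ (funkEnergy U o)) z τ τ := by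
  obtain ⟨hc2, hev⟩ := hc
  have hL := isMinkowskiEnergy_funkEnergy hU hUk ho
  set L := funkEnergy U o
  have hlam : 0 < 1 - Real.exp (-r) := by
    have : Real.exp (-r) < 1 := by simpa using hr
    linarith
  set lam := 1 - Real.exp (-r)
  have hcU : c s ∈ U := hev.self_of_nhds.1.1
  have hcirc : ∀ᶠ t in 𝓝 s, c t - o ∈ P ∧ funkMetric U o (c t - o) = lam :=
    hev.mono fun t ht => (mem_funkCircle_iff hU ho P hr (c t)).1 ht.1
  set z : ℝ → E n := fun t => lam⁻¹ • (c t - o)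
  have hcz : ∀ t, c t - o = lam • z t := fun t => by
    simp only [z, smul_smul, mul_inv_cancel₀ hlam.ne', one_smul]
  have hz : ∀ᶠ t in 𝓝 s, L (z t) = 1 / 2 := by
    filter_upwards [hcirc] with t ht
    refine funkEnergy_eq_half ?_
    rw [funkMetric_smul hU ho (inv_pos.2 hlam).le, ht.2, inv_mul_cancel₀ hlam.ne']
  -- `Θ(c, ċ) = 1` means `c + ċ ∈ ∂U`, a condition which can be read off at `o` as well.
  have hw : ∀ᶠ t in 𝓝 s, L (c t - o + deriv c t) = 1 / 2 := by
    filter_upwards [hev] with t ht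
    refine funkEnergy_eq_half ?_
    rw [funkMetric_eq_one_iff hU ho, show o + (c t - o + deriv c t) = c t + deriv c t by abel,
      ← funkMetric_eq_one_iff hU ht.1.1]
    exact ht.2
  have hd1 : ∀ᶠ t in 𝓝 s, HasDerivAt c (deriv c t) t :=
    (eventually_differentiableAt hc2).mono fun t ht => ht.hasDerivAt
  have hd2 : HasDerivAt (deriv c) (deriv (deriv c) s) s := by
    have h : DifferentiableAt ℝ (fun t => fderiv ℝ c t 1) s :=
      (differentiableAt_fderiv hc2).clm_apply (differentiableAt_const 1)
    exact DifferentiableAt.hasDerivAt h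
  have hdz : ∀ᶠ t in 𝓝 s, HasDerivAt z (lam⁻¹ • deriv c t) t :=
    hd1.mono fun t ht => (ht.sub_const o).const_smul lam⁻¹
  have htan : ∀ᶠ t in 𝓝 s, fderiv ℝ L (z t) (deriv c t) = 0 := by
    filter_upwards [hz.eventually_nhds, hdz] with t h1 h2
    have hLz := ((hL.contDiffAt _ (hL.ne_zero h1.self_of_nhds)).differentiableAt
      (by norm_num)).hasFDerivAt
    have h3 := (hLz.comp_hasDerivAt t h2).unique
      ((hasDerivAt_const t (1 / 2 : ℝ)).congr_of_eventuallyEq h1)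
    rw [map_smul, smul_eq_mul] at h3
    exact (mul_eq_zero.1 h3).resolve_left (inv_pos.2 hlam).ne'
  have hzs := hL.ne_zero hz.self_of_nhds
  have hsecond : lam⁻¹ * fderiv ℝ (fderiv ℝ L) (z s) (deriv c s) (deriv c s) +
      fderiv ℝ L (z s) (deriv (deriv c) s) = 0 := by
    have h1 : HasDerivAt (fun t => fderiv ℝ L (z t))
        (fderiv ℝ (fderiv ℝ L) (z s) (lam⁻¹ • deriv c s)) s :=
      (differentiableAt_fderiv (hL.contDiffAt_two hzs)).hasFDerivAt.comp_hasDerivAt s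
        hdz.self_of_nhds
    have h2 := (h1.clm_apply hd2).unique
      ((hasDerivAt_const s (0 : ℝ)).congr_of_eventuallyEq htan)
    simpa using h2
  -- The derivative of `c - o + ċ` is exactly the covariant acceleration, which is therefore tangent
  -- to the level set at `w`.
  have hwtan : fderiv ℝ L (c s - o + deriv c s) (deriv c s + deriv (deriv c) s) = 0 := by
    have hLw := ((hL.contDiffAt _ (hL.ne_zero hw.self_of_nhds)).differentiableAt
      (by norm_num)).hasFDerivAt
    exact (hLw.comp_hasDerivAt s ((hd1.self_of_nhds.sub_const o).add hd2)).unique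
      ((hasDerivAt_const s (1 / 2 : ℝ)).congr_of_eventuallyEq hw)
  have hPev : ∀ᶠ t in 𝓝 s, c t - o ∈ P := hcirc.mono fun t ht => ht.1
  have hd1P : ∀ᶠ t in 𝓝 s, deriv c t ∈ P := by
    filter_upwards [hd1, hPev.eventually_nhds] with t h1 h2
    exact hasDerivAt_mem_submodule h1 h2
  have hd2P : deriv (deriv c) s ∈ P :=
    hasDerivAt_mem_submodule (o := 0) hd2 (hd1P.mono fun t ht => by rwa [sub_zero])
  have hzP : z s ∈ P := P.smul_mem _ hPev.self_of_nhds
  have hτ0 : deriv c s ≠ 0 := by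
    intro h
    have h1 := hev.self_of_nhds.2
    rw [h, funkMetric_zero] at h1
    exact zero_ne_one h1
  have hDz : fderiv ℝ L (z s) (z s) = 1 := by
    rw [hL.euler _ hzs, hz.self_of_nhds]; norm_num
  -- `DL(z)` is `1` on `z` and `0` on `ċ ≠ 0`, so these two vectors span `P`, which contains the
  -- acceleration.
  have hli : LinearIndependent ℝ ![deriv c s, z s] := by
    rw [LinearIndependent.pair_iff]
    intro x y hxy
    have hy : y = 0 := by
      have := congrArg (fderiv ℝ L (z s)) hxy
      simpa [hDz, htan.self_of_nhds] using this
    rw [hy, zero_smul, add_zero, smul_eq_zero] at hxy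
    exact ⟨hxy.resolve_right hτ0, hy⟩
  obtain ⟨α, β, hab⟩ := exists_eq_add_smul_of_finrank_eq_two hP hd1P.self_of_nhds hzP hli
    (P.add_mem hd2P hd1P.self_of_nhds)
  refine ⟨z s, deriv c s, α, β, ?_, ?_, hz.self_of_nhds, htan.self_of_nhds, ?_, ?_, ?_⟩
  · rw [← hcz]; abel
  · rw [← hab]
    exact covariantAcceleration_eq hU hUk hcU hev.self_of_nhds.2
  · rw [← hcz]
    exact hw.self_of_nhds
  · rw [← hcz, ← hab, add_comm (deriv (deriv c) s)]
    exact hwtan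
  · have h1 := congrArg (fderiv ℝ L (z s)) hab
    simp only [map_add, map_smul, htan.self_of_nhds, hDz, smul_eq_mul] at h1
    have h2 : β = fderiv ℝ L (z s) (deriv (deriv c) s) := by linarith
    have h3 := mul_inv_cancel₀ hlam.ne'
    rw [h2]
    linear_combination lam * hsecond
      - fderiv ℝ (fderiv ℝ L) (z s) (deriv c s) (deriv c s) * h3

/-- The Rund curvature of the forward Funk circles is `√2 - 1 + O(e^{-r/2})`, uniformly. -/
theorem exists_rundCurvature_bound (hU : IsFunkDomain U) (hUk : HasPositivelyCurvedC3Boundary U)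
    {o : E n} (ho : o ∈ U) :
    ∃ C R : ℝ, 0 < C ∧ ∀ r : ℝ, R ≤ r → ∀ P : Submodule ℝ (E n), Module.finrank ℝ P = 2 →
      ∀ (c : ℝ → E n) (s : ℝ), IsArcLengthParamAt (funkMetric U) (funkCircle U o P r) c s →
        |rundCurvature (funkMetric U) c s - (√2 - 1)| ≤ C * Real.exp (-r / 2) := by
  obtain ⟨K, ε₀, hK, hε₀, hray⟩ := (isMinkowskiEnergy_funkEnergy hU hUk ho).exists_ray_bound
  have hlim : Tendsto (fun r : ℝ => Real.exp (-r / 2)) atTop (𝓝 0) := by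
    have h : Tendsto (fun r : ℝ => r / 2) atTop atTop := tendsto_id.atTop_div_const two_pos
    simpa only [Function.comp_def, neg_div] using Real.tendsto_exp_neg_atTop_nhds_zero.comp h
  have hlim' : Tendsto (fun r : ℝ => Real.exp (-r)) atTop (𝓝 0) :=
    Real.tendsto_exp_neg_atTop_nhds_zero
  -- `R` ensures `K e^{-r/2} ≤ 1/2`, `e^{-r} < ε₀` and `r > 0`.
  obtain ⟨R, hR⟩ := eventually_atTop.1 (((hlim.eventually (gt_mem_nhds (show 0 < 1 / (2 * K) by
    positivity))).and (hlim'.eventually (gt_mem_nhds hε₀))).and (eventually_gt_atTop 0))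
  refine ⟨K, R, hK, fun r hr P hP c s hc => ?_⟩
  obtain ⟨⟨h1, h2⟩, hr0⟩ := hR r hr
  obtain ⟨z, τ, α, β, hcs, hacc, hz, hτ, hw, ha, hβ⟩ := exists_tangent_data hU hUk ho hr0 hP hc
  have hcU : c s ∈ U := hc.2.self_of_nhds.1.1
  have hsq : Real.exp (-r / 2) ^ 2 = Real.exp (-r) := by
    rw [← Real.exp_nat_mul]; congr 1; push_cast; ring
  refine abs_sub_sqrt_two_sub_one_le (f := fun T => funkEnergy U o
    ((1 - Real.exp (-r)) • z + T • (α • τ + β • z))) (Real.sqrt_nonneg _) (Real.exp_pos _) hK ?_ ?_ ?_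
  · rw [lt_div_iff₀ (by positivity)] at h1
    linarith
  · intro T hT
    have := hray z τ (Real.exp (-r)) α β T (Real.exp_pos _) h2 hT hz hτ hw ha hβ
    rwa [← Real.exp_half, ← congrArg (· * (T ^ 2 - 2 * T - 1)) hsq] at this
  -- Both sides say that `c + T a ∈ U`, measured from `c` on the left and from `o` on the right.
  · intro T hT
    rw [rundCurvature_eq hU hcU, hacc, ← funkMetric_smul hU hcU hT.le,
      funkMetric_lt_one_iff hU hcU, funkEnergy_lt_half_iff hU ho, hcs, add_assoc]

end Curves

/-! ### Existence of arc length parametrizations. -/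

/-- An integral curve of a `C¹` field is `C²`. -/
theorem exists_contDiffAt_two_integral_curve {φ : ℝ → ℝ} {x₀ : ℝ} (hφ : ContDiffAt ℝ 1 φ x₀) :
    ∃ θ : ℝ → ℝ, θ 0 = x₀ ∧ ContDiffAt ℝ 2 θ 0 ∧
      ∀ᶠ s in 𝓝 0, HasDerivAt θ (φ (θ s)) s := by
  obtain ⟨θ, h0, ε, hε, hθ⟩ :=
    hφ.exists_forall_mem_closedBall_exists_eq_forall_mem_Ioo_hasDerivAt₀ 0
  have hmem : Ioo (0 - ε) (0 + ε) ∈ 𝓝 (0 : ℝ) := Ioo_mem_nhds (by linarith) (by linarith)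
  -- Bootstrap: if `θ` is `Cᵏ` with `k ≤ 1`, so is `θ' = φ ∘ θ`, and `θ` gains one derivative.
  have step : ∀ k : ℕ, k ≤ 1 → ContDiffAt ℝ k θ 0 → ContDiffAt ℝ (k + 1 : ℕ) θ 0 := by
    intro k hk hk'
    have hcomp : ContDiffAt ℝ k (fun s => φ (θ s)) 0 :=
      ContDiffAt.comp (g := φ) 0 (by rw [h0]; exact hφ.of_le (by exact_mod_cast hk)) hk'
    have := contDiffAt_succ_iff_hasFDerivAt (𝕜 := ℝ) (n := k) (f := θ) (x := 0)
    refine this.2 ⟨fun s => ContinuousLinearMap.toSpanSingleton ℝ (φ (θ s)),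
      ⟨_, hmem, fun s hs => (hθ s hs).hasFDerivAt⟩, ?_⟩
    exact (ContinuousLinearMap.toSpanSingletonCLE (𝕜 := ℝ) (E := ℝ)).contDiff.contDiffAt.comp 0
      hcomp
  have hzero : ContDiffAt ℝ (0 : ℕ) θ 0 :=
    contDiffAt_zero.2 ⟨_, hmem, fun s hs => (hθ s hs).continuousAt.continuousWithinAt⟩
  refine ⟨θ, h0, step 1 le_rfl (step 0 zero_le_one hzero), ?_⟩
  filter_upwards [hmem] with s hs using hθ s hs

section Existence

variable {n : ℕ} {U : Set (E n)}

/-- A regular `C³` curve in the domain has a `C²` parametrization by arc length. -/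
theorem exists_isArcLengthParamAt (hU : IsFunkDomain U) (hUk : HasPositivelyCurvedC3Boundary U)
    {S : Set (E n)} {γ : ℝ → E n} (hγ : ContDiffAt ℝ 3 γ 0) (hS : ∀ᶠ t in 𝓝 0, γ t ∈ S)
    (h0 : γ 0 ∈ U) (hreg : deriv γ 0 ≠ 0) :
    ∃ c : ℝ → E n, c 0 = γ 0 ∧ IsArcLengthParamAt (funkMetric U) S c 0 := by
  have hγ2 := hγ.of_le (show (2 : WithTop ℕ∞) ≤ 3 by norm_num)
  have hγ1 : ContDiffAt ℝ 1 (deriv γ) 0 := by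
    have h : ContDiffAt ℝ 1 (fun t => fderiv ℝ γ t 1) 0 :=
      (hγ2.fderiv_right (by norm_num)).clm_apply contDiffAt_const
    exact h
  set σ : ℝ → ℝ := fun t => funkMetric U (γ t) (deriv γ t)
  have hσ : ContDiffAt ℝ 1 σ 0 :=
    ContDiffAt.comp (g := fun p : E n × E n => funkMetric U p.1 p.2)
      (f := fun t => (γ t, deriv γ t)) 0 ((contDiffAt_funkMetric hU hUk h0 hreg).of_le (by norm_num))
      ((hγ.of_le (by norm_num)).prodMk hγ1)
  have hσ0 : 0 < σ 0 := funkMetric_pos hU h0 hreg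
  have hinv : ContDiffAt ℝ 1 (fun t => (σ t)⁻¹) 0 := hσ.inv hσ0.ne'
  -- Solving `θ' = 1 / σ(θ)`, with `σ` the Funk speed of `γ`, gives `γ ∘ θ` unit speed.
  obtain ⟨θ, hθ0, hθ2, hθ⟩ := exists_contDiffAt_two_integral_curve hinv
  have hθt : Tendsto θ (𝓝 0) (𝓝 0) := by
    have := hθ2.continuousAt.tendsto
    rwa [hθ0] at this
  refine ⟨fun s => γ (θ s), by simp only [hθ0], ?_, ?_⟩
  · exact ContDiffAt.comp (g := γ) (f := θ) 0 (by rwa [hθ0]) hθ2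
  filter_upwards [hθ, hθt.eventually hS, hθt.eventually (eventually_differentiableAt hγ2),
    hθt.eventually (hσ.continuousAt.eventually (lt_mem_nhds hσ0)),
    hθt.eventually (hγ.continuousAt.eventually (hU.isOpen.mem_nhds h0))] with s h1 h2 h3 h4 h5
  refine ⟨h2, ?_⟩
  have hd : HasDerivAt (fun s => γ (θ s)) ((σ (θ s))⁻¹ • deriv γ (θ s)) s :=
    h3.hasDerivAt.scomp s h1
  rw [hd.deriv, funkMetric_smul hU h5 (inv_pos.2 h4).le]
  exact inv_mul_cancel₀ h4.ne'

theorem funkCircle_nonempty (hU : IsFunkDomain U) {o : E n} (ho : o ∈ U)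
    {P : Submodule ℝ (E n)} (hP : Module.finrank ℝ P = 2) {r : ℝ} (hr : 0 < r) :
    (funkCircle U o P r).Nonempty := by
  have hne : P ≠ ⊥ := by
    rintro rfl
    simp at hP
  obtain ⟨v, hvP, hv⟩ := P.exists_mem_ne_zero_of_ne_bot hne
  have hF := funkMetric_pos hU ho hv
  have hlam : 0 < 1 - Real.exp (-r) := by
    have : Real.exp (-r) < 1 := by simpa using hr
    linarith
  refine ⟨o + ((1 - Real.exp (-r)) / funkMetric U o v) • v, ?_⟩
  rw [mem_funkCircle_iff hU ho P hr, add_sub_cancel_left, funkMetric_smul hU ho (by positivity),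
    div_mul_cancel₀ _ hF.ne']
  exact ⟨P.smul_mem _ hvP, rfl⟩

theorem exists_arcLengthParam_funkCircle (hU : IsFunkDomain U)
    (hUk : HasPositivelyCurvedC3Boundary U) {o : E n} (ho : o ∈ U) {P : Submodule ℝ (E n)}
    (hP : Module.finrank ℝ P = 2) {r : ℝ} (hr : 0 < r) {q : E n} (hq : q ∈ funkCircle U o P r) :
    ∃ c : ℝ → E n, c 0 = q ∧ IsArcLengthParamAt (funkMetric U) (funkCircle U o P r) c 0 := by
  have hqU : q ∈ U := hq.1
  obtain ⟨hvP, hFv⟩ := (mem_funkCircle_iff hU ho P hr q).1 hq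
  have hlam : 0 < 1 - Real.exp (-r) := by
    have : Real.exp (-r) < 1 := by simpa using hr
    linarith
  set lam := 1 - Real.exp (-r)
  set v := q - o
  have hv : v ≠ 0 := by
    intro h
    rw [h, funkMetric_zero] at hFv
    exact hlam.ne hFv
  obtain ⟨w, hwP, hw⟩ : ∃ w ∈ P, w ∉ Submodule.span ℝ {v} := by
    by_contra! hcon
    have h1 := Submodule.finrank_mono (show P ≤ Submodule.span ℝ {v} from hcon)
    rw [hP, finrank_span_singleton hv] at h1
    norm_num at h1
  have hne : ∀ t : ℝ, v + t • w ≠ 0 := by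
    intro t ht
    rcases eq_or_ne t 0 with rfl | h
    · exact hv (by simpa using ht)
    · refine hw (Submodule.mem_span_singleton.2 ⟨-t⁻¹, ?_⟩)
      rw [eq_neg_of_add_eq_zero_left ht, smul_neg, neg_smul, neg_neg, smul_smul,
        inv_mul_cancel₀ h, one_smul]
  -- The line `v + t w` in `P` is projected radially onto the circle; `w ∉ ℝ v` makes the resulting
  -- curve regular at `q`.
  set g : ℝ → ℝ := fun t => lam / funkMetric U o (v + t • w)
  set γ : ℝ → E n := fun t => o + g t • (v + t • w)
  have hFpos : ∀ t : ℝ, 0 < funkMetric U o (v + t • w) := fun t => funkMetric_pos hU ho (hne t)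
  have hg : ContDiffAt ℝ 3 g 0 := by
    refine contDiffAt_const.div ?_ (hFpos 0).ne'
    exact ContDiffAt.comp (g := funkMetric U o) 0
      (contDiffAt_funkMetric_right hU hUk ho (hne 0)) (by fun_prop)
  have hγ : ContDiffAt ℝ 3 γ 0 := contDiffAt_const.add (hg.smul (by fun_prop))
  have hg0 : g 0 = 1 := by simp [g, hFv, hlam.ne']
  have hγ0 : γ 0 = q := by simp [γ, hg0, v]
  have hS : ∀ t, γ t ∈ funkCircle U o P r := by
    intro t
    rw [mem_funkCircle_iff hU ho P hr, add_sub_cancel_left,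
      funkMetric_smul hU ho (div_pos hlam (hFpos t)).le, div_mul_cancel₀ _ (hFpos t).ne']
    exact ⟨P.smul_mem _ (P.add_mem hvP (P.smul_mem _ hwP)), rfl⟩
  have hreg : deriv γ 0 ≠ 0 := by
    have hd : HasDerivAt γ (g 0 • w + deriv g 0 • (v + (0 : ℝ) • w)) 0 :=
      ((hg.differentiableAt (by norm_num)).hasDerivAt.smul
        (hasDerivAt_add_smul v w 0)).const_add o
    rw [hd.deriv, hg0, one_smul, zero_smul, add_zero]
    intro h
    refine hw (Submodule.mem_span_singleton.2 ⟨-deriv g 0, ?_⟩)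
    rw [neg_smul, eq_neg_of_add_eq_zero_left h]
  obtain ⟨c, hc0, hc⟩ := exists_isArcLengthParamAt hU hUk hγ (Eventually.of_forall hS)
    (by rwa [hγ0]) hreg
  exact ⟨c, hc0.trans hγ0, hc⟩

end Existence

end FunkGeometry

end

theorem theorem3 (n : ℕ) (hn : 2 ≤ n) (U : Set (FunkGeometry.E n))
    (hUo : IsOpen U) (hUb : Bornology.IsBounded U) (hUc : Convex ℝ U)
    (hUk : FunkGeometry.HasPositivelyCurvedC3Boundary U)
    (o : FunkGeometry.E n) (ho : o ∈ U) :
    -- the circles are nonempty curves that can be parametrized by arc length around each point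
    (∀ P : Submodule ℝ (FunkGeometry.E n), Module.finrank ℝ P = 2 → ∀ r : ℝ, 0 < r →
      (FunkGeometry.funkCircle U o P r).Nonempty ∧
      ∀ q ∈ FunkGeometry.funkCircle U o P r, ∃ c : ℝ → FunkGeometry.E n, c 0 = q ∧
        FunkGeometry.IsArcLengthParamAt (FunkGeometry.funkMetric U)
          (FunkGeometry.funkCircle U o P r) c 0) ∧
    -- uniform convergence of the Rund curvature to `√2 - 1`
    (∀ ε : ℝ, 0 < ε → ∃ R : ℝ, ∀ r : ℝ, R ≤ r →
      ∀ P : Submodule ℝ (FunkGeometry.E n), Module.finrank ℝ P = 2 →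
      ∀ (c : ℝ → FunkGeometry.E n) (s : ℝ),
        FunkGeometry.IsArcLengthParamAt (FunkGeometry.funkMetric U)
          (FunkGeometry.funkCircle U o P r) c s →
        |FunkGeometry.rundCurvature (FunkGeometry.funkMetric U) c s - (Real.sqrt 2 - 1)| < ε) ∧
    -- the deviation from the limit is of order `e^{-r/2}`, uniformly
    (∃ C R : ℝ, ∀ r : ℝ, R ≤ r →
      ∀ P : Submodule ℝ (FunkGeometry.E n), Module.finrank ℝ P = 2 →
      ∀ (c : ℝ → FunkGeometry.E n) (s : ℝ),
        FunkGeometry.IsArcLengthParamAt (FunkGeometry.funkMetric U)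
          (FunkGeometry.funkCircle U o P r) c s →
        |FunkGeometry.rundCurvature (FunkGeometry.funkMetric U) c s - (Real.sqrt 2 - 1)|
          ≤ C * Real.exp (-r / 2)) := by
  have hU : FunkGeometry.IsFunkDomain U := ⟨hUo, hUb, hUc⟩
  obtain ⟨C, R, hC, hbound⟩ := FunkGeometry.exists_rundCurvature_bound hU hUk ho
  refine ⟨fun P hP r hr => ⟨FunkGeometry.funkCircle_nonempty hU ho hP hr, fun q hq =>
    FunkGeometry.exists_arcLengthParam_funkCircle hU hUk ho hP hr hq⟩, ?_, C, R, hbound⟩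
  intro ε hε
  have h : Filter.Tendsto (fun r : ℝ => r / 2) Filter.atTop Filter.atTop :=
    Filter.tendsto_id.atTop_div_const two_pos
  have hlim : Filter.Tendsto (fun r : ℝ => C * Real.exp (-r / 2)) Filter.atTop (nhds 0) := by
    have := (Real.tendsto_exp_neg_atTop_nhds_zero.comp h).const_mul C
    simpa only [Function.comp_def, neg_div, mul_zero] using this
  obtain ⟨R', hR'⟩ := Filter.eventually_atTop.1 (hlim.eventually (gt_mem_nhds hε))
  exact ⟨max R R', fun r hr P hP c s hc =>
    (hbound r ((le_max_left _ _).trans hr) P hP c s hc).trans_lt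
      (hR' r ((le_max_right _ _).trans hr))⟩
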